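/- **The calculus.** Capture sets $C$ are finite sets of term variables, possibly containing the special symbol $*$ (never bound in an environment, not counted as a free variable). Expressions are taken up to renaming of bound variables; all variables bound in an environment are distinct. * Values $v ::= \lambda(x:T)\,t \mid \lambda[X<:S]\,t \mid \Box x$; answers $a ::= v \mid x$; terms $s,t ::= a \mid x\,y \mid x\,[S] \mid \mathsf{let}\ x = s\ \mathsf{in}\ t \mid C\multimap x$ (unboxing of $x$ with key $C$). * Shape types $S ::= X \mid \top \mid \forall(x:U)T \mid \forall[X<:S]T \mid \Box T$; types $T,U ::= S \mid C\,S$, with $\{\}\,S$ identified with $S$. * Environments $\Gamma ::= \cdot \mid \Gamma, x:T \mid \Gamma, X<:S$, each entry being well-formed in the preceding part: its free variables are bound there, and its capture sets may also contain $*$. *Captured variables.* $\mathrm{cv}(\lambda(x:T)t)=\mathrm{cv}(t)\setminus x$; $\mathrm{cv}(\lambda[X<:S]t)=\mathrm{cv}(t)$; $\mathrm{cv}(x)=\{x\}$; $\mathrm{cv}(x\,y)=\{x,y\}$; $\mathrm{cv}(x[S])=\{x\}$; $\mathrm{cv}(\Box x)=\{\}$; $\mathrm{cv}(C\multimap x)=C\cup\{x\}$;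 $\mathrm{cv}(\mathsf{let}\ x=v\ \mathsf{in}\ t)=\mathrm{cv}(t)$ if $v$ is a value and $x\notin\mathrm{cv}(t)$; otherwise $\mathrm{cv}(\mathsf{let}\ x=s\ \mathsf{in}\ t)=\mathrm{cv}(s)\cup(\mathrm{cv}(t)\setminus x)$. *Subcapturing* $\Gamma\vdash C_1<:C_2$ is generated by: $\Gamma\vdash\{x\}<:C$ if $x\in C$ (where $x$ may be $*$); $\Gamma\vdash C_1<:C_2$ if $\Gamma\vdash\{x\}<:C_2$ for all $x\in C_1$; $\Gamma\vdash\{x\}<:C$ if $x:C'\,S\in\Gamma$ and $\Gamma\vdash C'<:C$. *Subtyping* $\Gamma\vdash T_1<:T_2$ is generated by reflexivity, transitivity, and: $X<:S$ if $X<:S\in\Gamma$; $S<:\top$; $\forall(x:U_1)T_1<:\forall(x:U_2)T_2$ if $\Gamma\vdash U_2<:U_1$ and $\Gamma,x:U_2\vdash T_1<:T_2$; $\forall[X<:S_1]T_1<:\forall[X<:S_2]T_2$ if $\Gamma\vdash S_2<:S_1$ and $\Gamma,X<:S_2\vdash T_1<:T_2$; $\Box T_1<:\Box T_2$ if $\Gamma\vdash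 T_1<:T_2$; $C_1S_1<:C_2S_2$ if $\Gamma\vdash C_1<:C_2$ and $\Gamma\vdash S_1<:S_2$. *Typing* $\Gamma\vdash t:T$ (all types well-formed in their environments) is generated by: $x:\{x\}\,S$ if $x:C\,S\in\Gamma$; subsumption; $\lambda(x:U)t:(\mathrm{cv}(t)\setminus x)\,\forall(x:U)T$ if $\Gamma,x:U\vdash t:T$; $\lambda[X<:S]t:\mathrm{cv}(t)\,\forall[X<:S]T$ if $\Gamma,X<:S\vdash t:T$; $x\,y:[z:=y]T$ if $x:C\,\forall(z:U)T$ and $y:U$; $x[S]:[X:=S]T$ if $x:C\,\forall[X<:S]T$; $\Box x:\Box\,C\,S$ if $x:C\,S$ and $C\subseteq\mathrm{dom}(\Gamma)$; $C\multimap x:C\,S$ if $x:\Box\,C\,S$ and $C\subseteq\mathrm{dom}(\Gamma)$; $\mathsf{let}\ x=s\ \mathsf{in}\ t:U$ if $s:T$, $\Gamma,x:T\vdash t:U$ and $x\notin\mathrm{fv}(U)$. (As $*\notin\mathrm{dom}(\Gamma)$, the sets $C$ of the two box rules do not contain $*$.) *Evaluation.* With store contexts $\sigma::=[\,]\mid\mathsf{let}\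 x=v\ \mathsf{in}\ \sigma$ and evaluation contexts $e::=[\,]\mid\mathsf{let}\ x=e\ \mathsf{in}\ t$, the steps are (apply) $\sigma[e[x\,y]]\to\sigma[e[[z:=y]t]]$ if $\sigma(x)=\lambda(z:T)t$; (tapply) $\sigma[e[x[S]]]\to\sigma[e[[X:=S]t]]$ if $\sigma(x)=\lambda[X<:S']t$; (open) $\sigma[e[C\multimap x]]\to\sigma[e[y]]$ if $\sigma(x)=\Box y$; (rename) $\sigma[e[\mathsf{let}\ x=y\ \mathsf{in}\ t]]\to\sigma[e[[x:=y]t]]$; (lift) $\sigma[e[\mathsf{let}\ x=v\ \mathsf{in}\ t]]\to\sigma[\mathsf{let}\ x=v\ \mathsf{in}\ e[t]]$ if $e\ne[\,]$. The set of variables *used* in a step is $\{x\}$ for (apply) and (tapply) as displayed, and empty for the other rules; the set used in a reduction sequence is the union over its steps. *Programs.* A platform $\Psi$ is a store context all of whose bound values $v$ satisfy $\mathrm{fv}(v)=\{\}$; the variables in $\mathrm{dom}\,\Psi$ are the primitive capabilities. The matching relation $\Gamma\vdash\sigma\sim\Delta$ is given by $\Gamma\vdash[\,]\sim\cdot$,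 and $\Gamma\vdash\mathsf{let}\ x=v\ \mathsf{in}\ \sigma\sim x:T,\Delta$ whenever $\Gamma\vdash v:T$, $x\notin\mathrm{fv}(T)$ and $\Gamma,x:T\vdash\sigma\sim\Delta$. The term $\Psi[t]$ is a *well-typed program* if there are $\Delta$ and $T$ with $\vdash\Psi\sim\Delta$ and $\Delta\vdash t:T$ such that every $x\in\mathrm{dom}\,\Psi$ has $x:\{*\}\,S\in\Delta$ for some $S$. **Lemma (Used capability prediction / Program trace prediction).** Let $\Psi[t]$ be a well-typed program that reduces in zero or more steps to $\Psi[t']$. Then every primitive capability $x\in\mathrm{dom}\,\Psi$ used during this reduction lies in $\mathrm{cv}(t)$ (the *authority* of $t$). -/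

import Mathlib

/-!
The capture calculus: dependently typed System F-sub in monadic normal form, with capturing
types and boxes.

Terms and types are taken up to renaming of bound variables, through well-scoped de Bruijn
indices: an expression with indices `n k` has its free term variables in `Fin n` and its free type
variables in `Fin k`; index `0` is the innermost binder.  Hence a type of scope `n k` is
well-formed in every environment `Ctx n k` (all its free variables are bound there, and `*` is
allowed), and side conditions such as `x ∉ fv(U)` are expressed by weakening.
-/

namespace CaptureCalc

/-! ### Capture sets -/

/-- A capture set: a finite set of term variables `some x`, possibly with the universal
capability `* = none`. -/
abbrev CapSet (n : ℕ) : Type := Finset (Option (Fin n))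

/-- The universal capture set `{*}`. -/
def CapSet.univCap {n : ℕ} : CapSet n := {none}

/-- Renaming of the variables of a capture set (`*` stays fixed). -/
def CapSet.ren {n n' : ℕ} (ρ : Fin n → Fin n') (C : CapSet n) : CapSet n' :=
  C.image (Option.map ρ)

/-- `C \ x`, where `x` is the innermost variable. -/
def CapSet.unbind {n : ℕ} (C : CapSet (n + 1)) : CapSet n :=
  Finset.univ.filter (fun a => Option.map Fin.succ a ∈ C)

/-- The term variables of a capture set. -/
def CapSet.vars {n : ℕ} (C : CapSet n) : Finset (Fin n) :=
  Finset.univ.filter (fun x => some x ∈ C)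

/-! ### Types -/

/-- The two layers of types. -/
inductive Layer : Type
  | shape
  | type

/-- Shape types `S ::= X | ⊤ | ∀(x : U) T | ∀[X <: S] T | □ T` and types `T ::= C S`.
A shape type `S` used as a type is `{} S`. -/
inductive Typ : Layer → ℕ → ℕ → Type
  | tvar {n k : ℕ} (X : Fin k) : Typ .shape n k
  | top {n k : ℕ} : Typ .shape n k
  | all {n k : ℕ} (U : Typ .type n k) (T : Typ .type (n + 1) k) : Typ .shape n k
  | tall {n k : ℕ} (S : Typ .shape n k) (T : Typ .type n (k + 1)) : Typ .shape n k
  | box {n k : ℕ} (T : Typ .type n k) : Typ .shape n k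
  | capt {n k : ℕ} (C : CapSet n) (S : Typ .shape n k) : Typ .type n k

abbrev Shape (n k : ℕ) : Type := Typ .shape n k

abbrev Ty (n k : ℕ) : Type := Typ .type n k

/-- Extension of a renaming under one binder. -/
def up {n n' : ℕ} (ρ : Fin n → Fin n') : Fin (n + 1) → Fin (n' + 1) :=
  Fin.cases 0 (fun x => (ρ x).succ)

/-- The renaming `[z := y]` of the innermost variable `z`. -/
def inst {n : ℕ} (y : Fin n) : Fin (n + 1) → Fin n :=
  Fin.cases y id

/-- Simultaneous renaming of term variables and of type variables in a type. -/
def Typ.ren : {l : Layer} → {n k n' k' : ℕ} → (Fin n → Fin n') → (Fin k → Fin k') →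
    Typ l n k → Typ l n' k'
  | _, _, _, _, _, _, ξ, .tvar X => .tvar (ξ X)
  | _, _, _, _, _, _, _, .top => .top
  | _, _, _, _, _, ρ, ξ, .all U T => .all (U.ren ρ ξ) (T.ren (up ρ) ξ)
  | _, _, _, _, _, ρ, ξ, .tall S T => .tall (S.ren ρ ξ) (T.ren ρ (up ξ))
  | _, _, _, _, _, ρ, ξ, .box T => .box (T.ren ρ ξ)
  | _, _, _, _, _, ρ, ξ, .capt C S => .capt (C.ren ρ) (S.ren ρ ξ)

/-- Weakening by one term variable. -/
def Typ.wkVar {l : Layer} {n k : ℕ} (T : Typ l n k) : Typ l (n + 1) k := T.ren Fin.succ id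

/-- Weakening by one type variable. -/
def Typ.wkTVar {l : Layer} {n k : ℕ} (T : Typ l n k) : Typ l n (k + 1) := T.ren id Fin.succ

/-- Extension of a type substitution under one type binder. -/
def upT {n k k' : ℕ} (τ : Fin k → Shape n k') : Fin (k + 1) → Shape n (k' + 1) :=
  Fin.cases (.tvar 0) (fun X => (τ X).wkTVar)

/-- The type substitution `[X := S]` of the innermost type variable `X`. -/
def instT {n k : ℕ} (S : Shape n k) : Fin (k + 1) → Shape n k :=
  Fin.cases S .tvar

/-- Simultaneous substitution of shape types for type variables in a type. -/
def Typ.tsubst : {l : Layer} → {n k k' : ℕ} → (Fin k → Shape n k') → Typ l n k → Typ l n k'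
  | _, _, _, _, τ, .tvar X => τ X
  | _, _, _, _, _, .top => .top
  | _, _, _, _, τ, .all U T => .all (U.tsubst τ) (T.tsubst (fun X => (τ X).wkVar))
  | _, _, _, _, τ, .tall S T => .tall (S.tsubst τ) (T.tsubst (upT τ))
  | _, _, _, _, τ, .box T => .box (T.tsubst τ)
  | _, _, _, _, τ, .capt C S => .capt C (S.tsubst τ)

/-- Removal of the innermost variable from a set of variables. -/
def unbindVars {n : ℕ} (A : Finset (Fin (n + 1))) : Finset (Fin n) :=
  Finset.univ.filter (fun x => x.succ ∈ A)

/-- Free term variables of a type. -/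
def Typ.fv : {l : Layer} → {n k : ℕ} → Typ l n k → Finset (Fin n)
  | _, _, _, .tvar _ => ∅
  | _, _, _, .top => ∅
  | _, _, _, .all U T => U.fv ∪ unbindVars T.fv
  | _, _, _, .tall S T => S.fv ∪ T.fv
  | _, _, _, .box T => T.fv
  | _, _, _, .capt C S => C.vars ∪ S.fv

/-! ### Terms -/

/-- Terms: variables, `λ(x : U) t`, `λ[X <: S] t`, `□ x`, `x y`, `x [S]`, `let x = s in t`, and the
unboxing of `x` with key `C`. -/
inductive Tm : ℕ → ℕ → Type
  | var {n k : ℕ} (x : Fin n) : Tm n k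
  | lam {n k : ℕ} (U : Ty n k) (t : Tm (n + 1) k) : Tm n k
  | tlam {n k : ℕ} (S : Shape n k) (t : Tm n (k + 1)) : Tm n k
  | box {n k : ℕ} (x : Fin n) : Tm n k
  | app {n k : ℕ} (x y : Fin n) : Tm n k
  | tapp {n k : ℕ} (x : Fin n) (S : Shape n k) : Tm n k
  | letIn {n k : ℕ} (s : Tm n k) (t : Tm (n + 1) k) : Tm n k
  | unbox {n k : ℕ} (C : CapSet n) (x : Fin n) : Tm n k

/-- The values are `λ(x : U) t`, `λ[X <: S] t` and `□ x`. -/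
def Tm.isVal {n k : ℕ} : Tm n k → Bool
  | .lam _ _ => true
  | .tlam _ _ => true
  | .box _ => true
  | _ => false

/-- Simultaneous renaming of term variables and of type variables in a term. -/
def Tm.ren : {n k n' k' : ℕ} → (Fin n → Fin n') → (Fin k → Fin k') → Tm n k → Tm n' k'
  | _, _, _, _, ρ, _, .var x => .var (ρ x)
  | _, _, _, _, ρ, ξ, .lam U t => .lam (U.ren ρ ξ) (t.ren (up ρ) ξ)
  | _, _, _, _, ρ, ξ, .tlam S t => .tlam (S.ren ρ ξ) (t.ren ρ (up ξ))
  | _, _, _, _, ρ, _, .box x => .box (ρ x)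
  | _, _, _, _, ρ, _, .app x y => .app (ρ x) (ρ y)
  | _, _, _, _, ρ, ξ, .tapp x S => .tapp (ρ x) (S.ren ρ ξ)
  | _, _, _, _, ρ, ξ, .letIn s t => .letIn (s.ren ρ ξ) (t.ren (up ρ) ξ)
  | _, _, _, _, ρ, _, .unbox C x => .unbox (C.ren ρ) (ρ x)

/-- Simultaneous substitution of shape types for type variables in a term. -/
def Tm.tsubst : {n k k' : ℕ} → (Fin k → Shape n k') → Tm n k → Tm n k'
  | _, _, _, _, .var x => .var x
  | _, _, _, τ, .lam U t => .lam (U.tsubst τ) (t.tsubst (fun X => (τ X).wkVar))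
  | _, _, _, τ, .tlam S t => .tlam (S.tsubst τ) (t.tsubst (upT τ))
  | _, _, _, _, .box x => .box x
  | _, _, _, _, .app x y => .app x y
  | _, _, _, τ, .tapp x S => .tapp x (S.tsubst τ)
  | _, _, _, τ, .letIn s t => .letIn (s.tsubst τ) (t.tsubst (fun X => (τ X).wkVar))
  | _, _, _, _, .unbox C x => .unbox C x

/-- Free term variables of a term, including those of its type annotations and keys. -/
def Tm.fv : {n k : ℕ} → Tm n k → Finset (Fin n)
  | _, _, .var x => {x}
  | _, _, .lam U t => U.fv ∪ unbindVars t.fv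
  | _, _, .tlam S t => S.fv ∪ t.fv
  | _, _, .box x => {x}
  | _, _, .app x y => {x, y}
  | _, _, .tapp x S => {x} ∪ S.fv
  | _, _, .letIn s t => s.fv ∪ unbindVars t.fv
  | _, _, .unbox C x => C.vars ∪ {x}

/-- Captured variables `cv(t)`: boxes hide their content, unboxing counts its key, and a value
bound by `let` is counted only if the bound variable is captured in the body. -/
def Tm.cv : {n k : ℕ} → Tm n k → CapSet n
  | _, _, .var x => {some x}
  | _, _, .lam _ t => t.cv.unbind
  | _, _, .tlam _ t => t.cv
  | _, _, .box _ => ∅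
  | _, _, .app x y => {some x, some y}
  | _, _, .tapp x _ => {some x}
  | _, _, .letIn s t =>
      if s.isVal = true ∧ some 0 ∉ t.cv then t.cv.unbind else s.cv ∪ t.cv.unbind
  | _, _, .unbox C x => C ∪ {some x}

/-! ### Environments -/

/-- Environments `Γ ::= · | Γ, x : T | Γ, X <: S`; each entry is a type in the scope of the
preceding ones. -/
inductive Ctx : ℕ → ℕ → Type
  | empty : Ctx 0 0
  | consVar {n k : ℕ} (Γ : Ctx n k) (T : Ty n k) : Ctx (n + 1) k
  | consTVar {n k : ℕ} (Γ : Ctx n k) (S : Shape n k) : Ctx n (k + 1)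

/-- The type `T` with `x : T ∈ Γ`, in the scope of `Γ`. -/
def Ctx.var : {n k : ℕ} → Ctx n k → Fin n → Ty n k
  | _, _, .empty => fun x => x.elim0
  | _, _, .consVar Γ T => Fin.cases T.wkVar (fun x => (Γ.var x).wkVar)
  | _, _, .consTVar Γ _ => fun x => (Γ.var x).wkTVar

/-- The bound `S` with `X <: S ∈ Γ`, in the scope of `Γ`. -/
def Ctx.tvar : {n k : ℕ} → Ctx n k → Fin k → Shape n k
  | _, _, .empty => fun X => X.elim0
  | _, _, .consVar Γ _ => fun X => (Γ.tvar X).wkVar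
  | _, _, .consTVar Γ S => Fin.cases S.wkTVar (fun X => (Γ.tvar X).wkTVar)

/-! ### Subcapturing, subtyping, typing -/

/-- Subcapturing `Γ ⊢ C₁ <: C₂`. -/
inductive Subcapt {n k : ℕ} (Γ : Ctx n k) : CapSet n → CapSet n → Prop
  | elem {a : Option (Fin n)} {C : CapSet n} (h : a ∈ C) : Subcapt Γ {a} C
  | set {C D : CapSet n} (h : ∀ a ∈ C, Subcapt Γ {a} D) : Subcapt Γ C D
  | var {x : Fin n} {C' C : CapSet n} {S : Shape n k} (hx : Γ.var x = .capt C' S)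
      (h : Subcapt Γ C' C) : Subcapt Γ {some x} C

/-- Subtyping `Γ ⊢ T₁ <: T₂`, for shape types and for types. -/
inductive Subtyp : {l : Layer} → {n k : ℕ} → Ctx n k → Typ l n k → Typ l n k → Prop
  | refl {l : Layer} {n k : ℕ} {Γ : Ctx n k} {T : Typ l n k} : Subtyp Γ T T
  | trans {l : Layer} {n k : ℕ} {Γ : Ctx n k} {T₁ T₂ T₃ : Typ l n k}
      (h₁ : Subtyp Γ T₁ T₂) (h₂ : Subtyp Γ T₂ T₃) : Subtyp Γ T₁ T₃
  | tvar {n k : ℕ} {Γ : Ctx n k} {X : Fin k} : Subtyp Γ (.tvar X) (Γ.tvar X)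
  | top {n k : ℕ} {Γ : Ctx n k} {S : Shape n k} : Subtyp Γ S .top
  | all {n k : ℕ} {Γ : Ctx n k} {U₁ U₂ : Ty n k} {T₁ T₂ : Ty (n + 1) k}
      (hU : Subtyp Γ U₂ U₁) (hT : Subtyp (Γ.consVar U₂) T₁ T₂) :
      Subtyp Γ (.all U₁ T₁) (.all U₂ T₂)
  | tall {n k : ℕ} {Γ : Ctx n k} {S₁ S₂ : Shape n k} {T₁ T₂ : Ty n (k + 1)}
      (hS : Subtyp Γ S₂ S₁) (hT : Subtyp (Γ.consTVar S₂) T₁ T₂) :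
      Subtyp Γ (.tall S₁ T₁) (.tall S₂ T₂)
  | box {n k : ℕ} {Γ : Ctx n k} {T₁ T₂ : Ty n k} (h : Subtyp Γ T₁ T₂) :
      Subtyp Γ (.box T₁) (.box T₂)
  | capt {n k : ℕ} {Γ : Ctx n k} {C₁ C₂ : CapSet n} {S₁ S₂ : Shape n k}
      (hC : Subcapt Γ C₁ C₂) (hS : Subtyp Γ S₁ S₂) : Subtyp Γ (.capt C₁ S₁) (.capt C₂ S₂)

/-- `C ⊆ dom(Γ)`: every variable of the scope is bound in `Γ`, and `*` is not. -/
def CapSet.InDom {n k : ℕ} (C : CapSet n) (_ : Ctx n k) : Prop :=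
  ∀ a ∈ C, ∃ x : Fin n, a = some x

/-- Typing `Γ ⊢ t : T`. -/
inductive HasType : {n k : ℕ} → Ctx n k → Tm n k → Ty n k → Prop
  | var {n k : ℕ} {Γ : Ctx n k} {x : Fin n} {C : CapSet n} {S : Shape n k}
      (hx : Γ.var x = .capt C S) : HasType Γ (.var x) (.capt {some x} S)
  | sub {n k : ℕ} {Γ : Ctx n k} {t : Tm n k} {T U : Ty n k}
      (ht : HasType Γ t T) (h : Subtyp Γ T U) : HasType Γ t U
  | abs {n k : ℕ} {Γ : Ctx n k} {U : Ty n k} {t : Tm (n + 1) k} {T : Ty (n + 1) k}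
      (ht : HasType (Γ.consVar U) t T) :
      HasType Γ (.lam U t) (.capt t.cv.unbind (.all U T))
  | tabs {n k : ℕ} {Γ : Ctx n k} {S : Shape n k} {t : Tm n (k + 1)} {T : Ty n (k + 1)}
      (ht : HasType (Γ.consTVar S) t T) :
      HasType Γ (.tlam S t) (.capt t.cv (.tall S T))
  | app {n k : ℕ} {Γ : Ctx n k} {x y : Fin n} {C : CapSet n} {U : Ty n k} {T : Ty (n + 1) k}
      (hx : HasType Γ (.var x) (.capt C (.all U T))) (hy : HasType Γ (.var y) U) :
      HasType Γ (.app x y) (T.ren (inst y) id)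
  | tapp {n k : ℕ} {Γ : Ctx n k} {x : Fin n} {C : CapSet n} {S : Shape n k} {T : Ty n (k + 1)}
      (hx : HasType Γ (.var x) (.capt C (.tall S T))) :
      HasType Γ (.tapp x S) (T.tsubst (instT S))
  | box {n k : ℕ} {Γ : Ctx n k} {x : Fin n} {C : CapSet n} {S : Shape n k}
      (hx : HasType Γ (.var x) (.capt C S)) (hC : C.InDom Γ) :
      HasType Γ (.box x) (.capt ∅ (.box (.capt C S)))
  | unbox {n k : ℕ} {Γ : Ctx n k} {x : Fin n} {C : CapSet n} {S : Shape n k}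
      (hx : HasType Γ (.var x) (.capt ∅ (.box (.capt C S)))) (hC : C.InDom Γ) :
      HasType Γ (.unbox C x) (.capt C S)
  | letIn {n k : ℕ} {Γ : Ctx n k} {s : Tm n k} {t : Tm (n + 1) k} {T U : Ty n k}
      (hs : HasType Γ s T) (ht : HasType (Γ.consVar T) t U.wkVar) :
      HasType Γ (.letIn s t) U

/-! ### Evaluation -/

/-- Store contexts `σ ::= [] | let x = v in σ`, with scope `n` outside and scope `m` at the
hole. -/
inductive Store (k : ℕ) : ℕ → ℕ → Type
  | nil {n : ℕ} : Store k n n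
  | cons {n m : ℕ} (v : Tm n k) (hv : v.isVal = true) (σ : Store k (n + 1) m) : Store k n m

/-- The term `σ[t]`. -/
def Store.plug {k : ℕ} : {n m : ℕ} → Store k n m → Tm m k → Tm n k
  | _, _, .nil, t => t
  | _, _, .cons v _ σ, t => .letIn v (σ.plug t)

/-- The variables of the outer scope, as variables of the scope of the hole. -/
def Store.wk {k : ℕ} : {n m : ℕ} → Store k n m → Fin n → Fin m
  | _, _, .nil, x => x
  | _, _, .cons _ _ σ, x => σ.wk x.succ

/-- `σ(x) = v`: the store `σ` binds `x` to `v` (both in the scope of the hole). -/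
inductive Store.Lookup {k : ℕ} : {n m : ℕ} → Store k n m → Fin m → Tm m k → Prop
  | here {n m : ℕ} {v : Tm n k} {hv : v.isVal = true} {σ : Store k (n + 1) m} :
      Store.Lookup (.cons v hv σ) (σ.wk 0) (v.ren (fun x => σ.wk x.succ) id)
  | there {n m : ℕ} {v : Tm n k} {hv : v.isVal = true} {σ : Store k (n + 1) m} {x : Fin m}
      {w : Tm m k} (h : Store.Lookup σ x w) : Store.Lookup (.cons v hv σ) x w

/-- Evaluation contexts `e ::= [] | let x = e in t`. -/
inductive ECtx (n k : ℕ) : Type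
  | hole : ECtx n k
  | letIn (e : ECtx n k) (t : Tm (n + 1) k) : ECtx n k

/-- The term `e[s]`. -/
def ECtx.plug {n k : ℕ} : ECtx n k → Tm n k → Tm n k
  | .hole, s => s
  | .letIn e t, s => .letIn (e.plug s) t

/-- Weakening of an evaluation context by one term variable. -/
def ECtx.wk {n k : ℕ} : ECtx n k → ECtx (n + 1) k
  | .hole => .hole
  | .letIn e t => .letIn e.wk (t.ren (up Fin.succ) id)

/-- Derivations of a reduction step. -/
inductive Step {n k : ℕ} : Tm n k → Tm n k → Type
  | apply {m : ℕ} (σ : Store k n m) (e : ECtx m k) (x y : Fin m) (U : Ty m k)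
      (t : Tm (m + 1) k) (h : σ.Lookup x (.lam U t)) :
      Step (σ.plug (e.plug (.app x y))) (σ.plug (e.plug (t.ren (inst y) id)))
  | tapply {m : ℕ} (σ : Store k n m) (e : ECtx m k) (x : Fin m) (S S' : Shape m k)
      (t : Tm m (k + 1)) (h : σ.Lookup x (.tlam S' t)) :
      Step (σ.plug (e.plug (.tapp x S))) (σ.plug (e.plug (t.tsubst (instT S))))
  | unboxing {m : ℕ} (σ : Store k n m) (e : ECtx m k) (C : CapSet m) (x y : Fin m)
      (h : σ.Lookup x (.box y)) :
      Step (σ.plug (e.plug (.unbox C x))) (σ.plug (e.plug (.var y)))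
  | rename {m : ℕ} (σ : Store k n m) (e : ECtx m k) (y : Fin m) (t : Tm (m + 1) k) :
      Step (σ.plug (e.plug (.letIn (.var y) t))) (σ.plug (e.plug (t.ren (inst y) id)))
  | lift {m : ℕ} (σ : Store k n m) (e : ECtx m k) (v : Tm m k) (t : Tm (m + 1) k)
      (hv : v.isVal = true) (he : e ≠ .hole) :
      Step (σ.plug (e.plug (.letIn v t))) (σ.plug (.letIn v (e.wk.plug t)))

/-- Derivations of a reduction in zero or more steps. -/
inductive Steps {n k : ℕ} : Tm n k → Tm n k → Type
  | refl (t : Tm n k) : Steps t t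
  | head {t₁ t₂ t₃ : Tm n k} (h : Step t₁ t₂) (r : Steps t₂ t₃) : Steps t₁ t₃

/-- The name of a variable that is independent of the scope in which it is considered: the number
of binders outside of its own (its de Bruijn level).  Reduction extends the store only at its
inner end, so this names one and the same store variable throughout a reduction. -/
def level {m : ℕ} (x : Fin m) : ℕ := m - 1 - (x : ℕ)

/-- The variables used in a step: the applied one in an application or a type application, none
otherwise. -/
def Step.used {n k : ℕ} {t s : Tm n k} : Step t s → Finset ℕ
  | .apply _ _ x _ _ _ _ => {level x}
  | .tapply _ _ x _ _ _ _ => {level x}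
  | .unboxing _ _ _ _ _ _ => ∅
  | .rename _ _ _ _ => ∅
  | .lift _ _ _ _ _ _ => ∅

/-- The variables used in a reduction. -/
def Steps.used {n k : ℕ} : {t s : Tm n k} → Steps t s → Finset ℕ
  | _, _, .refl _ => ∅
  | _, _, .head h r => h.used ∪ r.used

/-! ### Programs -/

/-- Matching environments `Γ ⊢ σ ~ Δ`; the last argument is `Γ, Δ`. -/
inductive Matches {k : ℕ} : {n m : ℕ} → Ctx n k → Store k n m → Ctx m k → Prop
  | nil {n : ℕ} {Γ : Ctx n k} : Matches Γ .nil Γ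
  | cons {n m : ℕ} {Γ : Ctx n k} {v : Tm n k} {hv : v.isVal = true} {σ : Store k (n + 1) m}
      {T : Ty n k} {Γ' : Ctx m k} (hσ : Matches (Γ.consVar T) σ Γ') (ht : HasType Γ v T) :
      Matches Γ (.cons v hv σ) Γ'

/-- A platform is a store context all of whose values have no free variables. -/
def Store.IsPlatform {k : ℕ} : {n m : ℕ} → Store k n m → Prop
  | _, _, .nil => True
  | _, _, .cons v _ σ => v.fv = ∅ ∧ σ.IsPlatform

/-- `Ψ[t]` is a well-typed program: `Ψ` is a platform, `⊢ Ψ ~ Δ` for some `Δ` that gives every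
variable of `Ψ` a type `{*} S`, and `Δ ⊢ t : T` for some `T`. -/
def WellTypedProgram {p : ℕ} (Ψ : Store 0 0 p) (t : Tm p 0) : Prop :=
  Ψ.IsPlatform ∧ ∃ Δ : Ctx p 0, Matches .empty Ψ Δ ∧
    (∀ x : Fin p, ∃ S : Shape p 0, Δ.var x = .capt CapSet.univCap S) ∧
    ∃ T : Ty p 0, HasType Δ t T

/-- The primitive capabilities (variables of the platform) that are used during a reduction of a
program with a platform of `p` variables; these have the levels below `p`. -/
def primitivesUsed (p : ℕ) {t s : Tm 0 0} (r : Steps t s) : Finset (Fin p) :=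
  Finset.univ.filter (fun x => level x ∈ r.used)

end CaptureCalc

namespace CaptureCalc

/-! ### Renaming lemmas -/

/-! The set `cv` is not itself preserved by reduction: a step can bring in store variables that were
not captured before, such as those inside an applied closure. So every store variable `x` is given a
footprint `R x`, a set of de Bruijn levels. A primitive capability is its own footprint. A variable
bound to any other value `v` gets the union of the footprints of `cv(v)`. The footprint of a capture
set is the union over its variables, and `*` contributes nothing. The invariant `Inv` says that the
store is well typed and that the footprint of the captured variables of the remaining term lies in a
set `L` fixed at the start. A used primitive is captured by the redex and is its own footprint, so
its level lies in `L`. With `L` the footprint of `cv(t)`, that is, the levels of its variables,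
injectivity of levels finishes the proof.

In `Step.inv`, application only unfolds footprints: the body of a closure captures at most its
argument and what the closure's variable already stands for. Unboxing is the step that needs types.
The content `y` of a box was not counted, but typing gives `{y} <: C` for the key `C`, and `C` does
not contain `*`. `Ctx.Sound.subcapt` turns this into an inclusion of footprints, and the key was
already counted. Primitives do not disturb soundness, since their declared capture set is `{*}`.
Types must therefore be preserved as well, which rests on `HasType.subst` and `Subtyp.belowShape`.
-/

theorem up_id {n : ℕ} : up (id : Fin n → Fin n) = id := by
  funext x; refine Fin.cases ?_ (fun x => ?_) x <;> simp [up]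

theorem up_comp {n n' n'' : ℕ} (ρ' : Fin n' → Fin n'') (ρ : Fin n → Fin n') :
    up (ρ' ∘ ρ) = up ρ' ∘ up ρ := by
  funext x; refine Fin.cases ?_ (fun x => ?_) x <;> simp [up]

theorem up_comp_succ {n n' : ℕ} (ρ : Fin n → Fin n') : up ρ ∘ Fin.succ = Fin.succ ∘ ρ := by
  funext x; simp [up]

theorem inst_comp_succ {n : ℕ} (y : Fin n) : inst y ∘ Fin.succ = id := by
  funext x; simp [inst]

theorem comp_inst {n n' : ℕ} (ρ : Fin n → Fin n') (y : Fin n) :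
    ρ ∘ inst y = inst (ρ y) ∘ up ρ := by
  funext x; refine Fin.cases ?_ (fun x => ?_) x <;> simp [up, inst]

theorem up_eq_zero {n n' : ℕ} (ρ : Fin n → Fin n') (x : Fin (n + 1)) : up ρ x = 0 ↔ x = 0 := by
  refine Fin.cases ?_ (fun x => ?_) x <;> simp [up, Fin.succ_ne_zero]

namespace CapSet

theorem mem_ren {n n' : ℕ} {ρ : Fin n → Fin n'} {C : CapSet n} {a : Option (Fin n')} :
    a ∈ C.ren ρ ↔ ∃ b ∈ C, Option.map ρ b = a := by
  simp [ren]

theorem none_mem_ren {n n' : ℕ} {ρ : Fin n → Fin n'} {C : CapSet n} :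
    none ∈ C.ren ρ ↔ none ∈ C := by
  simp [ren]

theorem some_mem_ren {n n' : ℕ} {ρ : Fin n → Fin n'} {C : CapSet n} {y : Fin n'} :
    some y ∈ C.ren ρ ↔ ∃ x, some x ∈ C ∧ ρ x = y := by
  simp [ren, Option.exists]

theorem mem_unbind {n : ℕ} {C : CapSet (n + 1)} {a : Option (Fin n)} :
    a ∈ C.unbind ↔ Option.map Fin.succ a ∈ C := by
  simp [unbind]

theorem ren_id {n : ℕ} (C : CapSet n) : C.ren id = C := by
  simp [ren]

theorem ren_ren {n n' n'' : ℕ} (ρ : Fin n → Fin n') (ρ' : Fin n' → Fin n'') (C : CapSet n) :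
    (C.ren ρ).ren ρ' = C.ren (ρ' ∘ ρ) := by
  simp [ren, Finset.image_image]

theorem ren_singleton {n n' : ℕ} (ρ : Fin n → Fin n') (a : Option (Fin n)) :
    ren ρ {a} = {Option.map ρ a} := by
  simp [ren]

theorem ren_union {n n' : ℕ} (ρ : Fin n → Fin n') (C D : CapSet n) :
    (C ∪ D).ren ρ = C.ren ρ ∪ D.ren ρ := by
  simp [ren, Finset.image_union]

/-- Even for a non-injective `ρ`, only `0` is sent to `0` by `up ρ`. Hence a substitution never
changes which clause of `cv` applies to a `let`. -/
theorem zero_mem_ren_up {n n' : ℕ} {ρ : Fin n → Fin n'} {C : CapSet (n + 1)} :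
    some 0 ∈ C.ren (up ρ) ↔ some 0 ∈ C := by
  simp [some_mem_ren, up_eq_zero]

theorem unbind_ren {n n' : ℕ} (ρ : Fin n → Fin n') (C : CapSet (n + 1)) :
    (C.ren (up ρ)).unbind = C.unbind.ren ρ := by
  ext (_ | y)
  · simp [mem_unbind, none_mem_ren]
  · rw [mem_unbind, Option.map_some, some_mem_ren, some_mem_ren]
    constructor
    · rintro ⟨x, hx, h⟩
      induction x using Fin.cases with
      | zero => exact absurd h (Fin.succ_ne_zero _).symm
      | succ x => exact ⟨x, mem_unbind.2 hx, Fin.succ_injective _ (by simpa [up] using h)⟩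
    · rintro ⟨x, hx, rfl⟩
      exact ⟨x.succ, mem_unbind.1 hx, by simp [up]⟩

end CapSet

/-! ### Combined renaming of term variables and substitution of type variables -/

/-- Simultaneous renaming of term variables and substitution of type variables in a type. -/
def Typ.sub : {l : Layer} → {n k n' k' : ℕ} → (Fin n → Fin n') → (Fin k → Shape n' k') →
    Typ l n k → Typ l n' k'
  | _, _, _, _, _, _, τ, .tvar X => τ X
  | _, _, _, _, _, _, _, .top => .top
  | _, _, _, _, _, ρ, τ, .all U T => .all (U.sub ρ τ) (T.sub (up ρ) (fun X => (τ X).wkVar))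
  | _, _, _, _, _, ρ, τ, .tall S T => .tall (S.sub ρ τ) (T.sub ρ (upT τ))
  | _, _, _, _, _, ρ, τ, .box T => .box (T.sub ρ τ)
  | _, _, _, _, _, ρ, τ, .capt C S => .capt (C.ren ρ) (S.sub ρ τ)

/-- Simultaneous renaming of term variables and substitution of type variables in a term. -/
def Tm.sub : {n k n' k' : ℕ} → (Fin n → Fin n') → (Fin k → Shape n' k') → Tm n k → Tm n' k'
  | _, _, _, _, ρ, _, .var x => .var (ρ x)
  | _, _, _, _, ρ, τ, .lam U t => .lam (U.sub ρ τ) (t.sub (up ρ) (fun X => (τ X).wkVar))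
  | _, _, _, _, ρ, τ, .tlam S t => .tlam (S.sub ρ τ) (t.sub ρ (upT τ))
  | _, _, _, _, ρ, _, .box x => .box (ρ x)
  | _, _, _, _, ρ, _, .app x y => .app (ρ x) (ρ y)
  | _, _, _, _, ρ, τ, .tapp x S => .tapp (ρ x) (S.sub ρ τ)
  | _, _, _, _, ρ, τ, .letIn s t => .letIn (s.sub ρ τ) (t.sub (up ρ) (fun X => (τ X).wkVar))
  | _, _, _, _, ρ, _, .unbox C x => .unbox (C.ren ρ) (ρ x)

theorem upT_tvar {n k k' : ℕ} (ξ : Fin k → Fin k') :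
    upT (fun X => (.tvar (ξ X) : Shape n k')) = fun X => .tvar (up ξ X) := by
  funext X; refine Fin.cases ?_ (fun X => ?_) X <;> simp [up, upT, Typ.wkTVar, Typ.ren]

/-- With `Typ.tsubst_eq_sub`, this makes renaming and type substitution instances of `sub`, so that
preservation of typing needs one induction only. -/
theorem Typ.ren_eq_sub {l : Layer} {n k n' k' : ℕ} (ρ : Fin n → Fin n') (ξ : Fin k → Fin k')
    (T : Typ l n k) : T.ren ρ ξ = T.sub ρ (fun X => .tvar (ξ X)) := by
  induction T generalizing n' k' <;>
    simp_all [Typ.ren, Typ.sub, upT_tvar, Typ.wkVar]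

theorem Typ.tsubst_eq_sub {l : Layer} {n k k' : ℕ} (τ : Fin k → Shape n k') (T : Typ l n k) :
    T.tsubst τ = T.sub id τ := by
  induction T generalizing k' <;> simp_all [Typ.tsubst, Typ.sub, up_id, CapSet.ren_id]

theorem Tm.ren_eq_sub {n k n' k' : ℕ} (ρ : Fin n → Fin n') (ξ : Fin k → Fin k')
    (t : Tm n k) : t.ren ρ ξ = t.sub ρ (fun X => .tvar (ξ X)) := by
  induction t generalizing n' k' <;>
    simp_all [Tm.ren, Tm.sub, upT_tvar, Typ.wkVar, Typ.ren, Typ.ren_eq_sub]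

theorem Tm.tsubst_eq_sub {n k k' : ℕ} (τ : Fin k → Shape n k') (t : Tm n k) :
    t.tsubst τ = t.sub id τ := by
  induction t generalizing k' <;>
    simp_all [Tm.tsubst, Tm.sub, up_id, CapSet.ren_id, Typ.tsubst_eq_sub]

namespace Typ

variable {l : Layer} {n k n' k' n'' k'' : ℕ}

theorem sub_id (T : Typ l n k) : T.sub id .tvar = T := by
  have e : ∀ {n k}, upT (.tvar : Fin k → Shape n k) = .tvar := by
    intro n k
    have := upT_tvar (n := n) (id : Fin k → Fin k)
    rw [up_id] at this
    exact this
  induction T <;> simp_all [Typ.sub, up_id, CapSet.ren_id, Typ.wkVar, Typ.ren]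

/-- The composition laws build on each other: the binder cases of `sub_ren` and `sub_sub` commute a
substitution with weakening, which follows from the laws before them. -/
theorem ren_sub (ρ : Fin n → Fin n') (ξ : Fin k → Fin k') (ρ' : Fin n' → Fin n'')
    (τ : Fin k' → Shape n'' k'') (T : Typ l n k) :
    (T.ren ρ ξ).sub ρ' τ = T.sub (ρ' ∘ ρ) (fun X => τ (ξ X)) := by
  have e : ∀ {n k k' k''} (ξ : Fin k → Fin k') (τ : Fin k' → Shape n k''),
      (fun X => upT τ (up ξ X)) = upT (fun X => τ (ξ X)) := by
    intro n k k' k'' ξ τ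
    funext X; refine Fin.cases ?_ (fun X => ?_) X <;> simp [up, upT]
  induction T generalizing n' k' n'' k'' <;>
    simp_all [Typ.ren, Typ.sub, up_comp, CapSet.ren_ren]

theorem ren_ren (ρ : Fin n → Fin n') (ξ : Fin k → Fin k') (ρ' : Fin n' → Fin n'')
    (ξ' : Fin k' → Fin k'') (T : Typ l n k) :
    (T.ren ρ ξ).ren ρ' ξ' = T.ren (ρ' ∘ ρ) (ξ' ∘ ξ) := by
  rw [ren_eq_sub ρ' ξ', ren_sub, ren_eq_sub]; rfl

theorem wkVar_ren (ρ : Fin n → Fin n') (ξ : Fin k → Fin k') (T : Typ l n k) :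
    T.wkVar.ren (up ρ) ξ = (T.ren ρ ξ).wkVar := by
  simp only [wkVar, ren_ren, up_comp_succ]; rfl

theorem wkTVar_ren (ρ : Fin n → Fin n') (ξ : Fin k → Fin k') (T : Typ l n k) :
    T.wkTVar.ren ρ (up ξ) = (T.ren ρ ξ).wkTVar := by
  simp only [wkTVar, ren_ren, up_comp_succ]; rfl

theorem sub_ren (ρ : Fin n → Fin n') (τ : Fin k → Shape n' k') (ρ' : Fin n' → Fin n'')
    (ξ : Fin k' → Fin k'') (T : Typ l n k) :
    (T.sub ρ τ).ren ρ' ξ = T.sub (ρ' ∘ ρ) (fun X => (τ X).ren ρ' ξ) := by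
  have e : ∀ {n n' k k' k''} (ρ : Fin n → Fin n') (ξ : Fin k' → Fin k'')
      (τ : Fin k → Shape n k'),
      (fun X => (upT τ X).ren ρ (up ξ)) = upT (fun X => (τ X).ren ρ ξ) := by
    intro n n' k k' k'' ρ ξ τ
    funext X; refine Fin.cases ?_ (fun X => ?_) X
    · simp [up, upT, Typ.ren]
    · simp [upT, wkTVar_ren]
  induction T generalizing n' k' n'' k'' <;>
    simp_all [Typ.ren, Typ.sub, up_comp, CapSet.ren_ren, wkVar_ren]

theorem wkVar_sub (ρ : Fin n → Fin n') (τ : Fin k → Shape n' k') (T : Typ l n k) :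
    T.wkVar.sub (up ρ) (fun X => (τ X).wkVar) = (T.sub ρ τ).wkVar := by
  simp only [wkVar, ren_sub, up_comp_succ, sub_ren]; rfl

theorem wkTVar_sub (ρ : Fin n → Fin n') (τ : Fin k → Shape n' k') (T : Typ l n k) :
    T.wkTVar.sub ρ (upT τ) = (T.sub ρ τ).wkTVar := by
  simp only [wkTVar, ren_sub, sub_ren]; rfl

theorem sub_sub (ρ : Fin n → Fin n') (τ : Fin k → Shape n' k') (ρ' : Fin n' → Fin n'')
    (τ' : Fin k' → Shape n'' k'') (T : Typ l n k) :
    (T.sub ρ τ).sub ρ' τ' = T.sub (ρ' ∘ ρ) (fun X => (τ X).sub ρ' τ') := by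
  have e : ∀ {n n' k k' k''} (ρ : Fin n → Fin n') (τ' : Fin k' → Shape n' k'')
      (τ : Fin k → Shape n k'),
      (fun X => (upT τ X).sub ρ (upT τ')) = upT (fun X => (τ X).sub ρ τ') := by
    intro n n' k k' k'' ρ ξ τ
    funext X; refine Fin.cases ?_ (fun X => ?_) X
    · simp [upT, Typ.sub]
    · simp [upT, wkTVar_sub]
  induction T generalizing n' k' n'' k'' <;>
    simp_all [Typ.sub, up_comp, CapSet.ren_ren, wkVar_sub]

theorem wkVar_ren_inst (y : Fin n) (T : Typ l n k) : T.wkVar.ren (inst y) id = T := by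
  rw [wkVar, ren_ren, inst_comp_succ, ren_eq_sub]; exact sub_id T

theorem wkTVar_sub_instT (S : Shape n k) (T : Typ l n k) : T.wkTVar.sub id (instT S) = T := by
  rw [wkTVar, ren_sub]; exact sub_id T

theorem wkVar_sub_inst (y : Fin n) (T : Typ l n k) : T.wkVar.sub (inst y) .tvar = T := by
  rw [wkVar, ren_sub, inst_comp_succ]; exact sub_id T

theorem ren_inst_sub (ρ : Fin n → Fin n') (τ : Fin k → Shape n' k') (y : Fin n)
    (T : Typ l (n + 1) k) :
    (T.ren (inst y) id).sub ρ τ =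
      (T.sub (up ρ) (fun X => (τ X).wkVar)).ren (inst (ρ y)) id := by
  simp only [ren_sub, sub_ren, comp_inst, wkVar_ren_inst]; rfl

theorem tsubst_instT_sub (ρ : Fin n → Fin n') (τ : Fin k → Shape n' k') (S : Shape n k)
    (T : Typ l n (k + 1)) :
    (T.tsubst (instT S)).sub ρ τ = (T.sub ρ (upT τ)).tsubst (instT (S.sub ρ τ)) := by
  simp only [tsubst_eq_sub, sub_sub]
  congr 1
  funext X; refine Fin.cases ?_ (fun X => ?_) X
  · simp [instT, upT, Typ.sub]
  · simp [instT, upT, Typ.sub, wkTVar_sub_instT]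

end Typ

/-! ### Captured variables under substitution -/

theorem Tm.isVal_sub {n k n' k' : ℕ} (ρ : Fin n → Fin n') (τ : Fin k → Shape n' k') (t : Tm n k) :
    (t.sub ρ τ).isVal = t.isVal := by
  cases t <;> rfl

/-- An equality is needed, not just an inclusion, because the rules for abstractions record `cv`
exactly in the type. Type annotations are not counted, so `τ` plays no role. -/
theorem Tm.cv_sub {n k n' k' : ℕ} (ρ : Fin n → Fin n') (τ : Fin k → Shape n' k') (t : Tm n k) :
    (t.sub ρ τ).cv = t.cv.ren ρ := by
  induction t generalizing n' k' with
  | letIn s t ihs iht =>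
    simp only [Tm.sub, Tm.cv, ihs, iht, Tm.isVal_sub, CapSet.zero_mem_ren_up, CapSet.unbind_ren]
    split_ifs <;> simp [CapSet.ren_union]
  | lam U t ih => simp only [Tm.sub, Tm.cv, ih, CapSet.unbind_ren]
  | tlam S t ih => simp only [Tm.sub, Tm.cv, ih]
  | _ => simp [Tm.sub, Tm.cv, CapSet.ren, Finset.image_insert]

theorem Tm.cv_ren {n k n' k' : ℕ} (ρ : Fin n → Fin n') (ξ : Fin k → Fin k') (t : Tm n k) :
    (t.ren ρ ξ).cv = t.cv.ren ρ := by
  rw [Tm.ren_eq_sub, Tm.cv_sub]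

theorem Tm.cv_tsubst {n k k' : ℕ} (τ : Fin k → Shape n k') (t : Tm n k) :
    (t.tsubst τ).cv = t.cv := by
  rw [Tm.tsubst_eq_sub, Tm.cv_sub, CapSet.ren_id]

theorem Tm.mem_fv_of_mem_cv {n k : ℕ} (t : Tm n k) {x : Fin n} (h : some x ∈ t.cv) :
    x ∈ t.fv := by
  induction t with
  | letIn s t ihs iht =>
    simp only [Tm.cv] at h
    simp only [Tm.fv, unbindVars, Finset.mem_union, Finset.mem_filter_univ]
    split_ifs at h
    · exact .inr (iht (CapSet.mem_unbind.1 h))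
    · exact (Finset.mem_union.1 h).imp ihs fun h => iht (CapSet.mem_unbind.1 h)
  | lam U t ih =>
    simp only [Tm.fv, unbindVars, Finset.mem_union, Finset.mem_filter_univ]
    exact .inr (ih (CapSet.mem_unbind.1 h))
  | tlam S t ih => exact Finset.mem_union_right _ (ih h)
  | _ => simp_all [Tm.fv, Tm.cv, CapSet.vars]

/-! ### Renaming of environments -/

/-- The capture set of a type. -/
def Typ.cap {n k : ℕ} : Ty n k → CapSet n
  | .capt C _ => C

/-- The shape of a type. -/
def Typ.shape {n k : ℕ} : Ty n k → Shape n k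
  | .capt _ S => S

theorem Typ.capt_cap_shape {n k : ℕ} (T : Ty n k) : .capt T.cap T.shape = T := by
  cases T; rfl

theorem Typ.cap_ren {n k n' k' : ℕ} (ρ : Fin n → Fin n') (ξ : Fin k → Fin k') (T : Ty n k) :
    (T.ren ρ ξ).cap = T.cap.ren ρ := by
  cases T; rfl

theorem Typ.shape_ren {n k n' k' : ℕ} (ρ : Fin n → Fin n') (ξ : Fin k → Fin k') (T : Ty n k) :
    (T.ren ρ ξ).shape = T.shape.ren ρ ξ := by
  cases T; rfl

theorem Typ.wkVar_def {l : Layer} {n k : ℕ} (T : Typ l n k) : T.wkVar = T.ren Fin.succ id := rfl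

theorem Typ.wkTVar_def {l : Layer} {n k : ℕ} (T : Typ l n k) : T.wkTVar = T.ren id Fin.succ := rfl

theorem Subcapt.of_mem {n k : ℕ} {Γ : Ctx n k} {C D : CapSet n} (h : Subcapt Γ C D)
    {a : Option (Fin n)} (ha : a ∈ C) : Subcapt Γ {a} D := by
  cases h with
  | elem h => rw [Finset.mem_singleton.1 ha]; exact .elem h
  | set h => exact h a ha
  | var hx h => rw [Finset.mem_singleton.1 ha]; exact .var hx h

theorem Subcapt.of_subset {n k : ℕ} {Γ : Ctx n k} {C D : CapSet n} (h : C ⊆ D) : Subcapt Γ C D :=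
  .set fun _ ha => .elem (h ha)

/-- Transitivity is admissible: at the `elem` leaves of the left derivation, `Subcapt.of_mem`
restricts the right one to a single element. -/
theorem Subcapt.trans {n k : ℕ} {Γ : Ctx n k} {C D E : CapSet n} (h : Subcapt Γ C D)
    (h' : Subcapt Γ D E) : Subcapt Γ C E := by
  induction h with
  | elem ha => exact h'.of_mem ha
  | set _ ih => exact .set fun a ha => ih a ha h'
  | var hx _ ih => exact .var hx (ih h')

/-- Strict renamings of environments. -/
structure Ctx.Ren {n k n' k' : ℕ} (Γ : Ctx n k) (Γ' : Ctx n' k') (ρ : Fin n → Fin n')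
    (ξ : Fin k → Fin k') : Prop where
  var : ∀ x, Γ'.var (ρ x) = (Γ.var x).ren ρ ξ
  tvar : ∀ X, Γ'.tvar (ξ X) = (Γ.tvar X).ren ρ ξ

namespace Ctx.Ren

variable {n k n' k' : ℕ} {Γ : Ctx n k} {Γ' : Ctx n' k'} {ρ : Fin n → Fin n'} {ξ : Fin k → Fin k'}

theorem consVar (h : Ctx.Ren Γ Γ' ρ ξ) (T : Ty n k) :
    Ctx.Ren (Γ.consVar T) (Γ'.consVar (T.ren ρ ξ)) (up ρ) ξ where
  var x := by
    refine Fin.cases ?_ (fun x => ?_) x <;> simp [Ctx.var, up, ← Typ.wkVar_ren, h.var]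
  tvar X := by simp [Ctx.tvar, Typ.wkVar_ren, h.tvar]

theorem consTVar (h : Ctx.Ren Γ Γ' ρ ξ) (S : Shape n k) :
    Ctx.Ren (Γ.consTVar S) (Γ'.consTVar (S.ren ρ ξ)) ρ (up ξ) where
  var x := by simp [Ctx.var, Typ.wkTVar_ren, h.var]
  tvar X := by
    refine Fin.cases ?_ (fun X => ?_) X <;> simp [Ctx.tvar, up, ← Typ.wkTVar_ren, h.tvar]

theorem wkVar (Γ : Ctx n k) (T : Ty n k) : Ctx.Ren Γ (Γ.consVar T) Fin.succ id where
  var _ := rfl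
  tvar _ := rfl

theorem wkTVar (Γ : Ctx n k) (S : Shape n k) : Ctx.Ren Γ (Γ.consTVar S) id Fin.succ where
  var _ := rfl
  tvar _ := rfl

theorem subcapt (h : Ctx.Ren Γ Γ' ρ ξ) {C D : CapSet n} (hs : Subcapt Γ C D) :
    Subcapt Γ' (C.ren ρ) (D.ren ρ) := by
  induction hs with
  | elem ha =>
    rw [CapSet.ren_singleton]
    exact .elem (CapSet.mem_ren.2 ⟨_, ha, rfl⟩)
  | set _ ih =>
    refine .set fun a ha => ?_
    obtain ⟨b, hb, rfl⟩ := CapSet.mem_ren.1 ha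
    rw [← CapSet.ren_singleton]
    exact ih b hb
  | @var x C' C S hx _ ih =>
    rw [CapSet.ren_singleton]
    exact .var (S := S.ren ρ ξ) (by rw [h.var, hx]; rfl) ih

end Ctx.Ren

/-- Proved before general substitution because extending a `Ctx.Mor` under a binder already uses
weakening. -/
theorem Subtyp.ren {l : Layer} {n k n' k' : ℕ} {Γ : Ctx n k} {Γ' : Ctx n' k'} {ρ : Fin n → Fin n'}
    {ξ : Fin k → Fin k'} {T₁ T₂ : Typ l n k} (hs : Subtyp Γ T₁ T₂) (h : Ctx.Ren Γ Γ' ρ ξ) :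
    Subtyp Γ' (T₁.ren ρ ξ) (T₂.ren ρ ξ) := by
  induction hs generalizing n' k' with
  | refl => exact .refl
  | trans _ _ ih₁ ih₂ => exact .trans (ih₁ h) (ih₂ h)
  | tvar => rw [← h.tvar]; exact .tvar
  | top => exact .top
  | all _ _ ih₁ ih₂ => exact .all (ih₁ h) (ih₂ (h.consVar _))
  | tall _ _ ih₁ ih₂ => exact .tall (ih₁ h) (ih₂ (h.consTVar _))
  | box _ ih => exact .box (ih h)
  | capt hC _ ih => exact .capt (h.subcapt hC) (ih h)

/-- The components of a subtyping between types. -/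
def Ctx.CaptLe {n k : ℕ} (Γ : Ctx n k) : {l : Layer} → Typ l n k → Typ l n k → Prop
  | .shape, _, _ => True
  | .type, T₁, T₂ => Subcapt Γ T₁.cap T₂.cap ∧ Subtyp Γ T₁.shape T₂.shape

theorem Subtyp.captLe {l : Layer} {n k : ℕ} {Γ : Ctx n k} {T₁ T₂ : Typ l n k}
    (h : Subtyp Γ T₁ T₂) : Γ.CaptLe T₁ T₂ := by
  induction h with
  | @refl l => cases l with
    | shape => trivial
    | type => exact ⟨.of_subset (Finset.Subset.refl _), .refl⟩
  | @trans l _ _ _ _ _ _ _ _ ih₁ ih₂ => cases l with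
    | shape => trivial
    | type => exact ⟨ih₁.1.trans ih₂.1, ih₁.2.trans ih₂.2⟩
  | capt hC hS => exact ⟨hC, hS⟩
  | _ => trivial

theorem Subtyp.cap_shape {n k : ℕ} {Γ : Ctx n k} {T₁ T₂ : Ty n k} (h : Subtyp Γ T₁ T₂) :
    Subcapt Γ T₁.cap T₂.cap ∧ Subtyp Γ T₁.shape T₂.shape :=
  h.captLe

/-! ### Substitution, weakening and narrowing -/

/-- Morphisms of environments: the variables of `Γ` are mapped to variables of `Γ'` that have the
translated types, and the type variables of `Γ` to shapes below the translated bounds. -/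
structure Ctx.Mor {n k n' k' : ℕ} (Γ : Ctx n k) (Γ' : Ctx n' k') (ρ : Fin n → Fin n')
    (τ : Fin k → Shape n' k') : Prop where
  -- Capture set and shape are compared separately. The variable rule assigns `{x}`, so only the
  -- singleton `{ρ x}` has to lie below. Asking this of the declared capture set of `ρ x` would
  -- exclude `[z := y]` when the type of `z` mentions `y` itself.
  cap : ∀ x, Subcapt Γ' {some (ρ x)} ((Γ.var x).cap.ren ρ)
  shape : ∀ x, Subtyp Γ' (Γ'.var (ρ x)).shape ((Γ.var x).shape.sub ρ τ)
  tvar : ∀ X, Subtyp Γ' (τ X) ((Γ.tvar X).sub ρ τ)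

theorem Subcapt.var_cap {n k : ℕ} (Γ : Ctx n k) (x : Fin n) :
    Subcapt Γ {some x} (Γ.var x).cap :=
  .var (Typ.capt_cap_shape _).symm (.of_subset (Finset.Subset.refl _))

namespace Ctx.Mor

variable {n k n' k' : ℕ} {Γ : Ctx n k} {Γ' : Ctx n' k'} {ρ : Fin n → Fin n'}
  {τ : Fin k → Shape n' k'}

theorem subcapt (h : Ctx.Mor Γ Γ' ρ τ) {C D : CapSet n} (hs : Subcapt Γ C D) :
    Subcapt Γ' (C.ren ρ) (D.ren ρ) := by
  induction hs with
  | elem ha =>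
    rw [CapSet.ren_singleton]
    exact .elem (CapSet.mem_ren.2 ⟨_, ha, rfl⟩)
  | set _ ih =>
    refine .set fun a ha => ?_
    obtain ⟨b, hb, rfl⟩ := CapSet.mem_ren.1 ha
    rw [← CapSet.ren_singleton]
    exact ih b hb
  | @var x C' C S hx _ ih =>
    have := h.cap x
    rw [hx] at this
    rw [CapSet.ren_singleton]
    exact this.trans ih

theorem consVar (h : Ctx.Mor Γ Γ' ρ τ) {T : Ty n k} {T' : Ty n' k'}
    (hT : Subtyp Γ' T' (T.sub ρ τ)) :
    Ctx.Mor (Γ.consVar T) (Γ'.consVar T') (up ρ) (fun X => (τ X).wkVar) where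
  cap x := by
    refine Fin.cases ?_ (fun x => ?_) x
    · refine (Subcapt.var_cap (Γ'.consVar T') 0).trans ?_
      have := (hT.ren (Ctx.Ren.wkVar Γ' T')).cap_shape.1
      change Subcapt _ T'.wkVar.cap (T.sub ρ τ).wkVar.cap at this
      rw [← Typ.wkVar_sub] at this
      revert this
      cases h : T with | capt C S => exact id
    · have := (Ctx.Ren.wkVar Γ' T').subcapt (h.cap x)
      simp only [CapSet.ren_singleton, CapSet.ren_ren, ← up_comp_succ, Option.map_some] at this
      rw [← CapSet.ren_ren, ← Typ.cap_ren Fin.succ id] at this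
      exact this
  shape x := by
    refine Fin.cases ?_ (fun x => ?_) x
    · have := (hT.ren (Ctx.Ren.wkVar Γ' T')).cap_shape.2
      change Subtyp _ T'.wkVar.shape (T.sub ρ τ).wkVar.shape at this
      rw [← Typ.wkVar_sub] at this
      revert this
      cases h : T with | capt C S => exact id
    · have := (h.shape x).ren (Ctx.Ren.wkVar Γ' T')
      rw [← Typ.shape_ren, ← Typ.wkVar, ← Typ.wkVar, ← Typ.wkVar_sub,
        Typ.wkVar_def (Γ.var x).shape, ← Typ.shape_ren] at this
      exact this
  tvar X := by
    have := (h.tvar X).ren (Ctx.Ren.wkVar Γ' T')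
    rw [← Typ.wkVar, ← Typ.wkVar, ← Typ.wkVar_sub] at this
    exact this

theorem consTVar (h : Ctx.Mor Γ Γ' ρ τ) {S : Shape n k} {S' : Shape n' k'}
    (hS : Subtyp Γ' S' (S.sub ρ τ)) :
    Ctx.Mor (Γ.consTVar S) (Γ'.consTVar S') ρ (upT τ) where
  cap x := by
    have := (Ctx.Ren.wkTVar Γ' S').subcapt (h.cap x)
    simp only [CapSet.ren_id] at this
    change Subcapt _ _ ((Γ.var x).wkTVar.cap.ren ρ)
    rw [Typ.wkTVar, Typ.cap_ren, CapSet.ren_id]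
    exact this
  shape x := by
    have := (h.shape x).ren (Ctx.Ren.wkTVar Γ' S')
    rw [← Typ.shape_ren, ← Typ.wkTVar, ← Typ.wkTVar, ← Typ.wkTVar_sub,
      Typ.wkTVar_def (Γ.var x).shape, ← Typ.shape_ren] at this
    exact this
  tvar X := by
    refine Fin.cases ?_ (fun X => ?_) X
    · have := hS.ren (Ctx.Ren.wkTVar Γ' S')
      rw [← Typ.wkTVar, ← Typ.wkTVar, ← Typ.wkTVar_sub] at this
      exact Subtyp.tvar.trans this
    · have := (h.tvar X).ren (Ctx.Ren.wkTVar Γ' S')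
      rw [← Typ.wkTVar, ← Typ.wkTVar, ← Typ.wkTVar_sub] at this
      exact this

/-- Narrowing is substitution along the identity between environments with smaller entries. -/
theorem id_of_le {Γ Γ' : Ctx n k} (h : ∀ x, Subtyp Γ' (Γ'.var x) (Γ.var x))
    (ht : ∀ X, Subtyp Γ' (Γ'.tvar X) (Γ.tvar X)) : Ctx.Mor Γ Γ' id .tvar where
  cap x := by
    rw [CapSet.ren_id]
    exact (Subcapt.var_cap Γ' x).trans (h x).cap_shape.1
  shape x := by
    rw [Typ.sub_id]
    exact (h x).cap_shape.2
  tvar X := by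
    rw [Typ.sub_id]
    exact Subtyp.tvar.trans (ht X)

end Ctx.Mor

theorem Ctx.Ren.mor {n k n' k' : ℕ} {Γ : Ctx n k} {Γ' : Ctx n' k'} {ρ : Fin n → Fin n'}
    {ξ : Fin k → Fin k'} (h : Ctx.Ren Γ Γ' ρ ξ) : Ctx.Mor Γ Γ' ρ (fun X => .tvar (ξ X)) where
  cap x := by
    have := Subcapt.var_cap Γ' (ρ x)
    rwa [h.var, Typ.cap_ren] at this
  shape x := by
    rw [h.var, Typ.shape_ren, Typ.ren_eq_sub]
    exact .refl
  tvar X := by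
    rw [← Typ.ren_eq_sub, ← h.tvar]
    exact .tvar

/-- The renaming `[z := y]` is a morphism if `y` has the type of `z`. -/
theorem Ctx.Mor.inst {n k : ℕ} {Γ : Ctx n k} {T : Ty n k} {y : Fin n}
    (hC : Subcapt Γ {some y} T.cap) (hS : Subtyp Γ (Γ.var y).shape T.shape) :
    Ctx.Mor (Γ.consVar T) Γ (inst y) .tvar where
  cap x := by
    refine Fin.cases ?_ (fun x => ?_) x
    · change Subcapt Γ {some y} (T.wkVar.cap.ren _)
      rwa [← Typ.cap_ren _ id, Typ.wkVar_ren_inst]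
    · change Subcapt Γ {some x} ((Γ.var x).wkVar.cap.ren _)
      rw [← Typ.cap_ren _ id, Typ.wkVar_ren_inst]
      exact .var_cap Γ x
  shape x := by
    refine Fin.cases ?_ (fun x => ?_) x
    · change Subtyp Γ (Γ.var y).shape (T.wkVar.shape.sub _ _)
      rwa [Typ.wkVar, Typ.shape_ren, ← Typ.wkVar, Typ.wkVar_sub_inst]
    · change Subtyp Γ (Γ.var x).shape ((Γ.var x).wkVar.shape.sub _ _)
      rw [Typ.wkVar, Typ.shape_ren, ← Typ.wkVar, Typ.wkVar_sub_inst]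
      exact .refl
  tvar X := by
    change Subtyp Γ (.tvar X) ((Γ.tvar X).wkVar.sub _ _)
    rw [Typ.wkVar_sub_inst]
    exact .tvar

/-- The type substitution `[X := S]` is a morphism if `S` is below the bound of `X`. -/
theorem Ctx.Mor.instT {n k : ℕ} {Γ : Ctx n k} {S S' : Shape n k} (hS : Subtyp Γ S S') :
    Ctx.Mor (Γ.consTVar S') Γ id (instT S) where
  cap x := by
    change Subcapt Γ {some x} ((Γ.var x).wkTVar.cap.ren id)
    rw [Typ.wkTVar, Typ.cap_ren, CapSet.ren_id, CapSet.ren_id]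
    exact .var_cap Γ x
  shape x := by
    change Subtyp Γ (Γ.var x).shape ((Γ.var x).wkTVar.shape.sub _ _)
    rw [Typ.wkTVar, Typ.shape_ren, ← Typ.wkTVar, Typ.wkTVar_sub_instT]
    exact .refl
  tvar X := by
    refine Fin.cases ?_ (fun X => ?_) X
    · change Subtyp Γ S (S'.wkTVar.sub _ _)
      rwa [Typ.wkTVar_sub_instT]
    · change Subtyp Γ (.tvar X) ((Γ.tvar X).wkTVar.sub _ _)
      rw [Typ.wkTVar_sub_instT]
      exact .tvar

theorem Subtyp.sub {l : Layer} {n k n' k' : ℕ} {Γ : Ctx n k} {Γ' : Ctx n' k'} {ρ : Fin n → Fin n'}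
    {τ : Fin k → Shape n' k'} {T₁ T₂ : Typ l n k} (hs : Subtyp Γ T₁ T₂)
    (h : Ctx.Mor Γ Γ' ρ τ) : Subtyp Γ' (T₁.sub ρ τ) (T₂.sub ρ τ) := by
  induction hs generalizing n' k' with
  | refl => exact .refl
  | trans _ _ ih₁ ih₂ => exact .trans (ih₁ h) (ih₂ h)
  | tvar => exact h.tvar _
  | top => exact .top
  | all _ _ ih₁ ih₂ => exact .all (ih₁ h) (ih₂ (h.consVar .refl))
  | tall _ _ ih₁ ih₂ => exact .tall (ih₁ h) (ih₂ (h.consTVar .refl))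
  | box _ ih => exact .box (ih h)
  | capt hC _ ih => exact .capt (h.subcapt hC) (ih h)

/-- Weakening, `[z := y]` and `[X := S]` are all instances. Only variables ever replace term
variables, which is why `cv` simply gets renamed. -/
theorem HasType.subst {n k n' k' : ℕ} {Γ : Ctx n k} {Γ' : Ctx n' k'} {ρ : Fin n → Fin n'}
    {τ : Fin k → Shape n' k'} {t : Tm n k} {T : Ty n k} (ht : HasType Γ t T)
    (h : Ctx.Mor Γ Γ' ρ τ) : HasType Γ' (t.sub ρ τ) (T.sub ρ τ) := by
  induction ht generalizing n' k' with
  | @var n k Γ x C S hx =>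
    refine .sub (.var (Typ.capt_cap_shape _).symm) (.capt ?_ ?_)
    · rw [CapSet.ren_singleton]; exact .elem (Finset.mem_singleton_self _)
    · simpa only [hx, Typ.shape] using h.shape x
  | sub _ hs ih => exact .sub (ih h) (hs.sub h)
  | @abs n k Γ U t T _ ih =>
    have := HasType.abs (ih (h.consVar .refl))
    rw [Tm.cv_sub, CapSet.unbind_ren] at this
    exact this
  | @tabs n k Γ S t T _ ih =>
    have := HasType.tabs (ih (h.consTVar .refl))
    rw [Tm.cv_sub] at this
    exact this
  | app _ _ ih₁ ih₂ =>
    rw [Typ.ren_inst_sub]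
    exact .app (ih₁ h) (ih₂ h)
  | tapp _ ih =>
    rw [Typ.tsubst_instT_sub]
    exact .tapp (ih h)
  | box _ hC ih =>
    refine .box (ih h) fun a ha => ?_
    obtain ⟨b, hb, rfl⟩ := CapSet.mem_ren.1 ha
    obtain ⟨x, rfl⟩ := hC b hb
    exact ⟨_, rfl⟩
  | unbox _ hC ih =>
    refine .unbox (ih h) fun a ha => ?_
    obtain ⟨b, hb, rfl⟩ := CapSet.mem_ren.1 ha
    obtain ⟨x, rfl⟩ := hC b hb
    exact ⟨_, rfl⟩
  | letIn _ _ ih₁ ih₂ =>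
    refine .letIn (ih₁ h) ?_
    rw [← Typ.wkVar_sub]
    exact ih₂ (h.consVar .refl)

theorem HasType.ren {n k n' k' : ℕ} {Γ : Ctx n k} {Γ' : Ctx n' k'} {ρ : Fin n → Fin n'}
    {ξ : Fin k → Fin k'} {t : Tm n k} {T : Ty n k} (ht : HasType Γ t T)
    (h : Ctx.Ren Γ Γ' ρ ξ) : HasType Γ' (t.ren ρ ξ) (T.ren ρ ξ) := by
  rw [Tm.ren_eq_sub, Typ.ren_eq_sub]
  exact ht.subst h.mor

/-! ### Inversion of subtyping -/

/-- The forms of a shape below a given shape. -/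
def Ctx.BelowShape {n k : ℕ} (Γ : Ctx n k) : {l : Layer} → Typ l n k → Typ l n k → Prop
  | _, T, .tvar _ => ∃ X, T = .tvar X
  | _, T, .all U₂ T₂ => (∃ X, T = .tvar X) ∨
      ∃ U₁ T₁, T = .all U₁ T₁ ∧ Subtyp Γ U₂ U₁ ∧ Subtyp (Γ.consVar U₂) T₁ T₂
  | _, T, .tall S₂ T₂ => (∃ X, T = .tvar X) ∨
      ∃ S₁ T₁, T = .tall S₁ T₁ ∧ Subtyp Γ S₂ S₁ ∧ Subtyp (Γ.consTVar S₂) T₁ T₂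
  | _, T, .box T₂ => (∃ X, T = .tvar X) ∨ ∃ T₁, T = .box T₁ ∧ Subtyp Γ T₁ T₂
  | _, _, .top => True
  | _, _, .capt _ _ => True

theorem Subtyp.narrowVar {l : Layer} {n k : ℕ} {Γ : Ctx n k} {U U' : Ty n k}
    {T₁ T₂ : Typ l (n + 1) k} (h : Subtyp (Γ.consVar U) T₁ T₂) (hU : Subtyp Γ U' U) :
    Subtyp (Γ.consVar U') T₁ T₂ := by
  have := h.sub (Ctx.Mor.id_of_le (Γ' := Γ.consVar U')
    (fun x => Fin.cases (hU.ren (.wkVar Γ U')) (fun _ => .refl) x) (fun _ => .refl))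
  rwa [Typ.sub_id, Typ.sub_id] at this

theorem Subtyp.narrowTVar {l : Layer} {n k : ℕ} {Γ : Ctx n k} {S S' : Shape n k}
    {T₁ T₂ : Typ l n (k + 1)} (h : Subtyp (Γ.consTVar S) T₁ T₂) (hS : Subtyp Γ S' S) :
    Subtyp (Γ.consTVar S') T₁ T₂ := by
  have := h.sub (Ctx.Mor.id_of_le (Γ' := Γ.consTVar S') (fun _ => .refl)
    (fun X => Fin.cases (hS.ren (.wkTVar Γ S')) (fun _ => .refl) X))
  rwa [Typ.sub_id, Typ.sub_id] at this

/-- Transitivity is a rule, so inversion needs an induction driven by the form of the larger shape.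
The disjunct with a type variable absorbs promotion to a bound. -/
theorem Subtyp.belowShape {l : Layer} {n k : ℕ} {Γ : Ctx n k} {T₁ T₂ : Typ l n k}
    (h : Subtyp Γ T₁ T₂) : Γ.BelowShape T₁ T₂ := by
  induction h with
  | @refl l n k Γ T => cases T with
    | tvar X => exact ⟨X, rfl⟩
    | top => trivial
    | all U T => exact .inr ⟨U, T, rfl, .refl, .refl⟩
    | tall U T => exact .inr ⟨U, T, rfl, .refl, .refl⟩
    | box T => exact .inr ⟨T, rfl, .refl⟩
    | capt => trivial
  | @trans l n k Γ T₁ T₂ T₃ h₁ h₂ ih₁ ih₂ => cases T₃ with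
    | tvar X => obtain ⟨Y, rfl⟩ := ih₂; exact ih₁
    | top => trivial
    | all U T =>
      obtain ⟨Y, rfl⟩ | ⟨U', T', rfl, hU, hT⟩ := ih₂
      · exact .inl ih₁
      · obtain ⟨Y, rfl⟩ | ⟨U'', T'', rfl, hU', hT'⟩ := ih₁
        · exact .inl ⟨Y, rfl⟩
        -- The first codomain comparison holds under the middle domain and must be narrowed to the
        -- smaller domain `U` before composing.
        · exact .inr ⟨_, _, rfl, hU.trans hU', (hT'.narrowVar hU).trans hT⟩
    | tall U T =>
      obtain ⟨Y, rfl⟩ | ⟨U', T', rfl, hU, hT⟩ := ih₂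
      · exact .inl ih₁
      · obtain ⟨Y, rfl⟩ | ⟨U'', T'', rfl, hU', hT'⟩ := ih₁
        · exact .inl ⟨Y, rfl⟩
        · exact .inr ⟨_, _, rfl, hU.trans hU', (hT'.narrowTVar hU).trans hT⟩
    | box T =>
      obtain ⟨Y, rfl⟩ | ⟨T', rfl, hT⟩ := ih₂
      · exact .inl ih₁
      · obtain ⟨Y, rfl⟩ | ⟨T'', rfl, hT'⟩ := ih₁
        · exact .inl ⟨Y, rfl⟩
        · exact .inr ⟨_, rfl, hT'.trans hT⟩
    | capt => trivial
  | @tvar n k Γ X =>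
    cases h : Γ.tvar X with
    | tvar Y => exact ⟨X, rfl⟩
    | top => trivial
    | all => exact .inl ⟨X, rfl⟩
    | tall => exact .inl ⟨X, rfl⟩
    | box => exact .inl ⟨X, rfl⟩
  | top => trivial
  | all hU hT => exact .inr ⟨_, _, rfl, hU, hT⟩
  | tall hS hT => exact .inr ⟨_, _, rfl, hS, hT⟩
  | box hT => exact .inr ⟨_, rfl, hT⟩
  | capt => trivial

/-- With no type variable in scope the promotion disjunct is void. This scope suffices because
redexes are never reached under a type binder. -/
theorem Subtyp.all_inv {n : ℕ} {Γ : Ctx n 0} {U₁ U₂ : Ty n 0} {T₁ T₂ : Ty (n + 1) 0}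
    (h : Subtyp Γ (.all U₁ T₁) (.all U₂ T₂)) :
    Subtyp Γ U₂ U₁ ∧ Subtyp (Γ.consVar U₂) T₁ T₂ := by
  obtain ⟨X, _⟩ | ⟨_, _, h, hU, hT⟩ := h.belowShape
  · exact X.elim0
  · cases h; exact ⟨hU, hT⟩

theorem Subtyp.tall_inv {n : ℕ} {Γ : Ctx n 0} {S₁ S₂ : Shape n 0} {T₁ T₂ : Ty n 1}
    (h : Subtyp Γ (.tall S₁ T₁) (.tall S₂ T₂)) :
    Subtyp Γ S₂ S₁ ∧ Subtyp (Γ.consTVar S₂) T₁ T₂ := by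
  obtain ⟨X, _⟩ | ⟨_, _, h, hU, hT⟩ := h.belowShape
  · exact X.elim0
  · cases h; exact ⟨hU, hT⟩

theorem Subtyp.box_inv {n : ℕ} {Γ : Ctx n 0} {T₁ T₂ : Ty n 0}
    (h : Subtyp Γ (.box T₁) (.box T₂)) : Subtyp Γ T₁ T₂ := by
  obtain ⟨X, _⟩ | ⟨_, h, hT⟩ := h.belowShape
  · exact X.elim0
  · cases h; exact hT

/-! ### Inversion of typing -/

namespace HasType

variable {n k : ℕ} {Γ : Ctx n k} {T : Ty n k}

theorem var_inv {x : Fin n} (h : HasType Γ (.var x) T) :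
    Subcapt Γ {some x} T.cap ∧ Subtyp Γ (Γ.var x).shape T.shape := by
  generalize e : Tm.var x = t at h
  induction h with
  | var hx =>
    cases e
    rw [hx]
    exact ⟨.elem (Finset.mem_singleton_self _), .refl⟩
  | sub _ hs ih =>
    obtain ⟨h₁, h₂⟩ := ih e
    exact ⟨h₁.trans hs.cap_shape.1, h₂.trans hs.cap_shape.2⟩
  | _ => cases e

theorem lam_inv {U : Ty n k} {t : Tm (n + 1) k} (h : HasType Γ (.lam U t) T) :
    ∃ T', HasType (Γ.consVar U) t T' ∧ Subcapt Γ t.cv.unbind T.cap ∧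
      Subtyp Γ (.all U T') T.shape := by
  generalize e : Tm.lam U t = s at h
  induction h with
  | abs ht => cases e; exact ⟨_, ht, .of_subset (Finset.Subset.refl _), .refl⟩
  | sub _ hs ih =>
    obtain ⟨T', h, h₁, h₂⟩ := ih e
    exact ⟨T', h, h₁.trans hs.cap_shape.1, h₂.trans hs.cap_shape.2⟩
  | _ => cases e

theorem tlam_inv {S : Shape n k} {t : Tm n (k + 1)} (h : HasType Γ (.tlam S t) T) :
    ∃ T', HasType (Γ.consTVar S) t T' ∧ Subcapt Γ t.cv T.cap ∧
      Subtyp Γ (.tall S T') T.shape := by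
  generalize e : Tm.tlam S t = s at h
  induction h with
  | tabs ht => cases e; exact ⟨_, ht, .of_subset (Finset.Subset.refl _), .refl⟩
  | sub _ hs ih =>
    obtain ⟨T', h, h₁, h₂⟩ := ih e
    exact ⟨T', h, h₁.trans hs.cap_shape.1, h₂.trans hs.cap_shape.2⟩
  | _ => cases e

theorem box_inv {x : Fin n} (h : HasType Γ (.box x) T) :
    ∃ T', HasType Γ (.var x) T' ∧ Subtyp Γ (.box T') T.shape := by
  generalize e : Tm.box x = s at h
  induction h with
  | box hx => cases e; exact ⟨_, hx, .refl⟩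
  | sub _ hs ih =>
    obtain ⟨T', h, h'⟩ := ih e
    exact ⟨T', h, h'.trans hs.cap_shape.2⟩
  | _ => cases e

theorem app_inv {x y : Fin n} (h : HasType Γ (.app x y) T) :
    ∃ U T', Subtyp Γ (Γ.var x).shape (.all U T') ∧ HasType Γ (.var y) U ∧
      Subtyp Γ (T'.ren (inst y) id) T := by
  generalize e : Tm.app x y = s at h
  induction h with
  | app hx hy => cases e; exact ⟨_, _, hx.var_inv.2, hy, .refl⟩
  | sub _ hs ih =>
    obtain ⟨U, T', h, hy, h'⟩ := ih e
    exact ⟨U, T', h, hy, h'.trans hs⟩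
  | _ => cases e

theorem tapp_inv {x : Fin n} {S : Shape n k} (h : HasType Γ (.tapp x S) T) :
    ∃ T', Subtyp Γ (Γ.var x).shape (.tall S T') ∧ Subtyp Γ (T'.tsubst (instT S)) T := by
  generalize e : Tm.tapp x S = s at h
  induction h with
  | tapp hx => cases e; exact ⟨_, hx.var_inv.2, .refl⟩
  | sub _ hs ih =>
    obtain ⟨T', h, h'⟩ := ih e
    exact ⟨T', h, h'.trans hs⟩
  | _ => cases e

theorem unbox_inv {C : CapSet n} {x : Fin n} (h : HasType Γ (.unbox C x) T) :
    ∃ S, Subtyp Γ (Γ.var x).shape (.box (.capt C S)) ∧ none ∉ C ∧ Subtyp Γ (.capt C S) T := by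
  generalize e : Tm.unbox C x = s at h
  induction h with
  | unbox hx hC =>
    cases e
    exact ⟨_, hx.var_inv.2, fun h => (hC _ h).elim (fun _ h => nomatch h), .refl⟩
  | sub _ hs ih =>
    obtain ⟨T', h, hC, h'⟩ := ih e
    exact ⟨T', h, hC, h'.trans hs⟩
  | _ => cases e

theorem letIn_inv {s : Tm n k} {t : Tm (n + 1) k} (h : HasType Γ (.letIn s t) T) :
    ∃ T', HasType Γ s T' ∧ HasType (Γ.consVar T') t T.wkVar := by
  generalize e : Tm.letIn s t = u at h
  induction h with
  | letIn hs ht => cases e; exact ⟨_, hs, ht⟩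
  | sub _ hs ih =>
    obtain ⟨T', h, h'⟩ := ih e
    exact ⟨T', h, .sub h' (hs.ren (.wkVar _ _))⟩
  | _ => cases e

/-- Special to values: the type of an application need not mention the variables it captures. This
makes the footprint of a stored value agree with its declared capture set. -/
theorem cv_of_isVal {v : Tm n k} (hv : v.isVal = true) (h : HasType Γ v T) :
    Subcapt Γ v.cv T.cap := by
  cases v with
  | lam U t => obtain ⟨_, _, h, _⟩ := h.lam_inv; exact h
  | tlam S t => obtain ⟨_, _, h, _⟩ := h.tlam_inv; exact h
  | box x => exact .of_subset (Finset.empty_subset _)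
  | _ => cases hv

theorem ren_inst {U : Ty n k} {t : Tm (n + 1) k} {T : Ty (n + 1) k} {y : Fin n}
    (ht : HasType (Γ.consVar U) t T) (hy : HasType Γ (.var y) U) :
    HasType Γ (t.ren (inst y) id) (T.ren (inst y) id) := by
  rw [Tm.ren_eq_sub, Typ.ren_eq_sub]
  exact ht.subst (.inst hy.var_inv.1 hy.var_inv.2)

theorem tsubst_instT {S S' : Shape n k} {t : Tm n (k + 1)} {T : Ty n (k + 1)}
    (ht : HasType (Γ.consTVar S') t T) (hS : Subtyp Γ S S') :
    HasType Γ (t.tsubst (instT S)) (T.tsubst (instT S)) := by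
  rw [Tm.tsubst_eq_sub, Typ.tsubst_eq_sub]
  exact ht.subst (.instT hS)

end HasType

/-! ### Preservation of types by the contraction of redexes -/

namespace HasType

variable {n : ℕ} {Γ : Ctx n 0} {T : Ty n 0}

theorem apply_contract {x y : Fin n} {U : Ty n 0} {t : Tm (n + 1) 0}
    (hv : HasType Γ (.lam U t) (Γ.var x)) (h : HasType Γ (.app x y) T) :
    HasType Γ (t.ren (inst y) id) T := by
  obtain ⟨T', ht, _, hT'⟩ := hv.lam_inv
  obtain ⟨U₂, T₂, hx, hy, hT⟩ := h.app_inv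
  obtain ⟨hU, hT₂⟩ := (hT'.trans hx).all_inv
  refine .sub (ht.ren_inst (.sub hy hU)) (.trans ?_ hT)
  rw [Typ.ren_eq_sub, Typ.ren_eq_sub]
  exact hT₂.sub (.inst hy.var_inv.1 hy.var_inv.2)

theorem tapply_contract {x : Fin n} {S S' : Shape n 0} {t : Tm n 1}
    (hv : HasType Γ (.tlam S' t) (Γ.var x)) (h : HasType Γ (.tapp x S) T) :
    HasType Γ (t.tsubst (instT S)) T := by
  obtain ⟨T', ht, _, hT'⟩ := hv.tlam_inv
  obtain ⟨T₂, hx, hT⟩ := h.tapp_inv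
  obtain ⟨hS, hT₂⟩ := (hT'.trans hx).tall_inv
  refine .sub (ht.tsubst_instT hS) (.trans ?_ hT)
  rw [Typ.tsubst_eq_sub, Typ.tsubst_eq_sub]
  -- The rule `tapp` requires the argument to be the bound itself, so reflexivity suffices here.
  exact hT₂.sub (.instT .refl)

/-- The last two conclusions let the key account for the content of the box. -/
theorem unbox_contract {C : CapSet n} {x y : Fin n}
    (hv : HasType Γ (.box y) (Γ.var x)) (h : HasType Γ (.unbox C x) T) :
    HasType Γ (.var y) T ∧ Subcapt Γ {some y} C ∧ none ∉ C := by
  obtain ⟨T', hy, hT'⟩ := hv.box_inv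
  obtain ⟨S, hx, hC, hT⟩ := h.unbox_inv
  have := HasType.sub hy (hT'.trans hx).box_inv
  exact ⟨.sub this hT, this.var_inv.1, hC⟩

theorem rename_contract {y : Fin n} {t : Tm (n + 1) 0} (h : HasType Γ (.letIn (.var y) t) T) :
    HasType Γ (t.ren (inst y) id) T := by
  obtain ⟨U, hy, ht⟩ := h.letIn_inv
  have := ht.ren_inst hy
  rwa [Typ.wkVar_ren_inst] at this

end HasType

/-! ### Footprints -/

/-- The footprint of a capture set, for an assignment of footprints to variables. -/
def CapSet.footprint {n : ℕ} (R : Fin n → Set ℕ) (C : CapSet n) : Set ℕ :=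
  {l | ∃ x, some x ∈ C ∧ l ∈ R x}

/-- Extension of an assignment of footprints by an innermost variable. -/
def extendFootprint {n : ℕ} (A : Set ℕ) (R : Fin n → Set ℕ) : Fin (n + 1) → Set ℕ :=
  Fin.cases A R

namespace CapSet

variable {n : ℕ} {R : Fin n → Set ℕ}

theorem footprint_subset {C : CapSet n} {L : Set ℕ} :
    C.footprint R ⊆ L ↔ ∀ x, some x ∈ C → R x ⊆ L :=
  ⟨fun h x hx _ hl => h ⟨x, hx, hl⟩, fun h _ ⟨x, hx, hl⟩ => h x hx hl⟩

theorem footprint_mono {C D : CapSet n} (h : C ⊆ D) : C.footprint R ⊆ D.footprint R :=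
  fun _ ⟨x, hx, hl⟩ => ⟨x, h hx, hl⟩

theorem footprint_union_subset {C D : CapSet n} {L : Set ℕ} :
    (C ∪ D).footprint R ⊆ L ↔ C.footprint R ⊆ L ∧ D.footprint R ⊆ L := by
  simp only [footprint_subset, Finset.mem_union, or_imp, forall_and]

theorem footprint_ren {n' : ℕ} (R : Fin n' → Set ℕ) (ρ : Fin n → Fin n') (C : CapSet n) :
    (C.ren ρ).footprint R = C.footprint (R ∘ ρ) := by
  ext l
  constructor
  · rintro ⟨y, hy, hl⟩
    obtain ⟨x, hx, rfl⟩ := some_mem_ren.1 hy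
    exact ⟨x, hx, hl⟩
  · rintro ⟨x, hx, hl⟩
    exact ⟨ρ x, some_mem_ren.2 ⟨x, hx, rfl⟩, hl⟩

theorem footprint_extend_subset {A : Set ℕ} {C : CapSet (n + 1)} {L : Set ℕ} :
    C.footprint (extendFootprint A R) ⊆ L ↔
      (some 0 ∈ C → A ⊆ L) ∧ C.unbind.footprint R ⊆ L := by
  simp only [footprint_subset, Fin.forall_fin_succ, mem_unbind]
  rfl

theorem footprint_ren_inst (y : Fin n) (C : CapSet (n + 1)) :
    (C.ren (inst y)).footprint R = C.footprint (extendFootprint (R y) R) := by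
  rw [footprint_ren]
  congr 1
  funext x; refine Fin.cases ?_ (fun x => ?_) x <;> rfl

end CapSet

theorem Tm.cv_letIn_of_not_isVal {n k : ℕ} {s : Tm n k} (hs : s.isVal = false)
    (t : Tm (n + 1) k) : (Tm.letIn s t).cv = s.cv ∪ t.cv.unbind := by
  simp [Tm.cv, hs]

theorem Tm.cv_letIn_subset {n k : ℕ} (s : Tm n k) (t : Tm (n + 1) k) :
    (Tm.letIn s t).cv ⊆ s.cv ∪ t.cv.unbind := by
  simp only [Tm.cv]
  split_ifs
  · exact Finset.subset_union_right
  · exact Finset.Subset.refl _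

/-- When `cv` omits the bound value, the bound variable is not captured in the body, so its
footprint is irrelevant. Otherwise `cv(s)` is counted in full. -/
theorem Tm.footprint_of_letIn {n k : ℕ} {R : Fin n → Set ℕ} {L : Set ℕ} {s : Tm n k}
    {t : Tm (n + 1) k} (h : (Tm.letIn s t).cv.footprint R ⊆ L) :
    t.cv.footprint (extendFootprint (s.cv.footprint R) R) ⊆ L := by
  rw [CapSet.footprint_extend_subset]
  simp only [Tm.cv] at h
  split_ifs at h with hc
  · exact ⟨fun h0 => absurd h0 hc.2, h⟩
  · rw [CapSet.footprint_union_subset] at h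
    exact ⟨fun _ => h.1, h.2⟩

/-- An assignment of footprints that agrees with the declared capture sets without `*`. -/
def Ctx.Sound {n k : ℕ} (Γ : Ctx n k) (R : Fin n → Set ℕ) : Prop :=
  ∀ x, none ∉ (Γ.var x).cap → R x ⊆ (Γ.var x).cap.footprint R

/-- Absence of `*` passes from the larger to the smaller set. It is carried along in the induction
because the `var` case may use soundness only for a declared capture set without `*`. -/
theorem Ctx.Sound.subcapt {n k : ℕ} {Γ : Ctx n k} {R : Fin n → Set ℕ} (h : Γ.Sound R)
    {C D : CapSet n} (hs : Subcapt Γ C D) (hD : none ∉ D) :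
    none ∉ C ∧ C.footprint R ⊆ D.footprint R := by
  induction hs with
  | elem ha =>
    have := Finset.singleton_subset_iff.2 ha
    exact ⟨fun h => hD (this h), CapSet.footprint_mono this⟩
  | set _ ih =>
    refine ⟨fun h => (ih _ h hD).1 (Finset.mem_singleton_self _),
      CapSet.footprint_subset.2 fun x hx => ?_⟩
    exact CapSet.footprint_subset.1 (ih _ hx hD).2 x (Finset.mem_singleton_self _)
  | @var x C' C S hx _ ih =>
    refine ⟨by simp, CapSet.footprint_subset.2 fun y hy => ?_⟩
    cases Finset.mem_singleton.1 hy
    have := h x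
    rw [hx] at this
    exact (this (ih hD).1).trans (ih hD).2

/-! ### Stores -/

/-- The value `v`, bound in a store in the scope of `Γ`, may be given the type `T` and the
footprint `A`; the primitive capabilities are those of a level below `p`, and they are their own
footprint. -/
structure EntryOK (p : ℕ) {n : ℕ} (Γ : Ctx n 0) (R : Fin n → Set ℕ) (v : Tm n 0) (T : Ty n 0)
    (A : Set ℕ) : Prop where
  typed : HasType Γ v T
  sound : none ∉ T.cap → A ⊆ T.cap.footprint R
  cv : v.cv.footprint R ⊆ A
  prim : n < p → A = {n}

/-- Matching of a store with an environment and an assignment of footprints. -/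
inductive StoreOK (p : ℕ) : {n m : ℕ} → Ctx n 0 → (Fin n → Set ℕ) → Store 0 n m → Ctx m 0 →
    (Fin m → Set ℕ) → Prop
  | nil {n : ℕ} {Γ : Ctx n 0} {R : Fin n → Set ℕ} : StoreOK p Γ R .nil Γ R
  | cons {n m : ℕ} {Γ : Ctx n 0} {R : Fin n → Set ℕ} {v : Tm n 0} {hv : v.isVal = true}
      {σ : Store 0 (n + 1) m} {T : Ty n 0} {A : Set ℕ} {Γ' : Ctx m 0} {R' : Fin m → Set ℕ}
      (h : EntryOK p Γ R v T A) (hσ : StoreOK p (Γ.consVar T) (extendFootprint A R) σ Γ' R') :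
      StoreOK p Γ R (.cons v hv σ) Γ' R'

theorem Ctx.Ren.refl {n k : ℕ} (Γ : Ctx n k) : Ctx.Ren Γ Γ id id where
  var x := by rw [Typ.ren_eq_sub]; exact (Typ.sub_id _).symm
  tvar X := by rw [Typ.ren_eq_sub]; exact (Typ.sub_id _).symm

theorem Ctx.Ren.trans {n k n' k' n'' k'' : ℕ} {Γ : Ctx n k} {Γ' : Ctx n' k'} {Γ'' : Ctx n'' k''}
    {ρ : Fin n → Fin n'} {ξ : Fin k → Fin k'} {ρ' : Fin n' → Fin n''} {ξ' : Fin k' → Fin k''}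
    (h : Ctx.Ren Γ Γ' ρ ξ) (h' : Ctx.Ren Γ' Γ'' ρ' ξ') : Ctx.Ren Γ Γ'' (ρ' ∘ ρ) (ξ' ∘ ξ) where
  var x := by rw [Function.comp_apply, h'.var, h.var, Typ.ren_ren]
  tvar X := by rw [Function.comp_apply, h'.tvar, h.tvar, Typ.ren_ren]

theorem level_zero (n : ℕ) : level (0 : Fin (n + 1)) = n := by
  simp [level]

theorem level_succ {n : ℕ} (x : Fin n) : level x.succ = level x := by
  simp only [level, Fin.val_succ]; omega

theorem level_lt {n : ℕ} (x : Fin n) : level x < n := by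
  have := x.isLt
  simp only [level]; omega

theorem level_injective {n : ℕ} : Function.Injective (level : Fin n → ℕ) := by
  intro x y h
  have := x.isLt
  have := y.isLt
  simp only [level] at h
  omega

/-- The primitive capabilities are their own footprint. -/
def PrimFootprint (p : ℕ) {n : ℕ} (R : Fin n → Set ℕ) : Prop :=
  ∀ x, level x < p → R x = {level x}

namespace EntryOK

variable {p n : ℕ} {Γ : Ctx n 0} {R : Fin n → Set ℕ} {v : Tm n 0} {T : Ty n 0} {A : Set ℕ}

theorem sound_consVar (h : EntryOK p Γ R v T A) (hR : Γ.Sound R) :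
    (Γ.consVar T).Sound (extendFootprint A R) := by
  intro x
  refine Fin.cases ?_ (fun x => ?_) x
  · change none ∉ T.wkVar.cap → A ⊆ T.wkVar.cap.footprint _
    rw [Typ.wkVar, Typ.cap_ren, CapSet.none_mem_ren, CapSet.footprint_ren]
    exact h.sound
  · change none ∉ (Γ.var x).wkVar.cap → R x ⊆ (Γ.var x).wkVar.cap.footprint _
    rw [Typ.wkVar, Typ.cap_ren, CapSet.none_mem_ren, CapSet.footprint_ren]
    exact hR x

theorem prim_extend (h : EntryOK p Γ R v T A) (hR : PrimFootprint p R) :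
    PrimFootprint p (extendFootprint A R) := by
  intro x
  refine Fin.cases ?_ (fun x => ?_) x
  · rw [level_zero]; exact h.prim
  · rw [level_succ]; exact hR x

theorem of_isVal (hR : Γ.Sound R) (hp : p ≤ n) (hv : v.isVal = true) (ht : HasType Γ v T) :
    EntryOK p Γ R v T (v.cv.footprint R) where
  typed := ht
  sound h := (hR.subcapt (ht.cv_of_isVal hv) h).2
  cv := subset_rfl
  prim h := absurd h hp.not_gt

end EntryOK

namespace StoreOK

variable {p n m : ℕ} {Γ : Ctx n 0} {R : Fin n → Set ℕ} {σ : Store 0 n m} {Γ' : Ctx m 0}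
  {R' : Fin m → Set ℕ}

theorem ren (h : StoreOK p Γ R σ Γ' R') : Ctx.Ren Γ Γ' σ.wk id := by
  induction h with
  | nil => exact .refl _
  | cons _ _ ih => exact (Ctx.Ren.wkVar _ _).trans ih

/-- Footprints consist of levels, which do not depend on the scope, so entering the store leaves
them unchanged. -/
theorem footprint_wk (h : StoreOK p Γ R σ Γ' R') : R' ∘ σ.wk = R := by
  induction h with
  | nil => rfl
  | cons _ _ ih =>
    funext x
    exact congrFun ih x.succ

theorem sound (h : StoreOK p Γ R σ Γ' R') (hR : Γ.Sound R) : Γ'.Sound R' := by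
  induction h with
  | nil => exact hR
  | cons h _ ih => exact ih (h.sound_consVar hR)

theorem prim (h : StoreOK p Γ R σ Γ' R') (hR : PrimFootprint p R) : PrimFootprint p R' := by
  induction h with
  | nil => exact hR
  | cons h _ ih => exact ih (h.prim_extend hR)

theorem lookup (h : StoreOK p Γ R σ Γ' R') {x : Fin m} {v : Tm m 0} (hx : σ.Lookup x v) :
    HasType Γ' v (Γ'.var x) ∧ v.cv.footprint R' ⊆ R' x := by
  induction h with
  | nil => cases hx
  | @cons n m Γ R v hv σ T A Γ' R' h hσ ih =>
    cases hx with
    | here =>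
      have hr := (Ctx.Ren.wkVar Γ T).trans hσ.ren
      constructor
      · rw [hσ.ren.var]
        have := h.typed.ren hr
        rw [Function.comp_id, ← Function.comp_id id, ← Typ.ren_ren] at this
        exact this
      · have h0 : R' (σ.wk 0) = A := congrFun hσ.footprint_wk 0
        have hs : R' ∘ (fun x => σ.wk x.succ) = R :=
          funext fun x => congrFun hσ.footprint_wk x.succ
        rw [Tm.cv_ren, CapSet.footprint_ren, h0, hs]
        exact h.cv
    | there hx => exact ih hx

end StoreOK

/-! ### Evaluation contexts -/

theorem ECtx.isVal_plug {n k : ℕ} (e : ECtx n k) {s : Tm n k} (hs : s.isVal = false) :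
    (e.plug s).isVal = false := by
  cases e with
  | hole => exact hs
  | letIn e t => rfl

theorem ECtx.typing {n k : ℕ} {Γ : Ctx n k} (e : ECtx n k) {s : Tm n k} {T : Ty n k}
    (h : HasType Γ (e.plug s) T) :
    ∃ U, HasType Γ s U ∧ (∀ s', HasType Γ s' U → HasType Γ (e.plug s') T) ∧
      ∀ V s', HasType (Γ.consVar V) s' U.wkVar →
        HasType (Γ.consVar V) (e.wk.plug s') T.wkVar := by
  induction e generalizing T with
  | hole => exact ⟨T, h, fun _ h => h, fun _ _ h => h⟩
  | letIn e t ih =>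
    obtain ⟨T', hs, ht⟩ := h.letIn_inv
    obtain ⟨U, h, h₁, h₂⟩ := ih hs
    refine ⟨U, h, fun s' hs' => .letIn (h₁ s' hs') ht, fun V s' hs' => .letIn (h₂ V s' hs') ?_⟩
    have := ht.ren ((Ctx.Ren.wkVar Γ V).consVar T')
    rwa [Typ.wkVar_ren] at this

/-- As `s` is not a value, no enclosing `let` omits its captured variables. A replacement may be a
value, but then `cv` of the `let` can only be smaller than the union. -/
theorem ECtx.footprint {n k : ℕ} {R : Fin n → Set ℕ} {L : Set ℕ} (e : ECtx n k) {s : Tm n k}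
    (hs : s.isVal = false) (h : (e.plug s).cv.footprint R ⊆ L) :
    s.cv.footprint R ⊆ L ∧ (∀ s', s'.cv.footprint R ⊆ L → (e.plug s').cv.footprint R ⊆ L) ∧
      ∀ A s', s'.cv.footprint (extendFootprint A R) ⊆ L →
        (e.wk.plug s').cv.footprint (extendFootprint A R) ⊆ L := by
  induction e with
  | hole => exact ⟨h, fun _ h => h, fun _ _ h => h⟩
  | letIn e t ih =>
    rw [ECtx.plug, Tm.cv_letIn_of_not_isVal (e.isVal_plug hs),
      CapSet.footprint_union_subset] at h
    obtain ⟨h₀, h₁, h₂⟩ := ih h.1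
    refine ⟨h₀, fun s' hs' => ?_, fun A s' hs' => ?_⟩
    · exact (CapSet.footprint_mono (Tm.cv_letIn_subset _ _)).trans
        (CapSet.footprint_union_subset.2 ⟨h₁ s' hs', h.2⟩)
    · refine (CapSet.footprint_mono (Tm.cv_letIn_subset _ _)).trans
        (CapSet.footprint_union_subset.2 ⟨h₂ A s' hs', ?_⟩)
      rw [Tm.cv_ren, CapSet.unbind_ren, CapSet.footprint_ren]
      exact h.2

/-! ### The invariant of reduction -/

/-- The term is a store, which matches some environment and contains the platform of `p` values,
around a well-typed term whose footprint lies in `L`. -/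
inductive Inv (p : ℕ) (L : Set ℕ) : {n : ℕ} → Ctx n 0 → (Fin n → Set ℕ) → Tm n 0 → Prop
  | cons {n : ℕ} {Γ : Ctx n 0} {R : Fin n → Set ℕ} {v : Tm n 0} {s : Tm (n + 1) 0} {T : Ty n 0}
      {A : Set ℕ} (hv : v.isVal = true) (h : EntryOK p Γ R v T A)
      (hs : Inv p L (Γ.consVar T) (extendFootprint A R) s) : Inv p L Γ R (.letIn v s)
  | body {n : ℕ} {Γ : Ctx n 0} {R : Fin n → Set ℕ} {s : Tm n 0} {T : Ty n 0} (hp : p ≤ n)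
      (hs : HasType Γ s T) (hL : s.cv.footprint R ⊆ L) : Inv p L Γ R s

theorem StoreOK.inv {p n m : ℕ} {L : Set ℕ} {Γ : Ctx n 0} {R : Fin n → Set ℕ} {σ : Store 0 n m}
    {Γ' : Ctx m 0} {R' : Fin m → Set ℕ} (h : StoreOK p Γ R σ Γ' R') {s : Tm m 0}
    (hs : Inv p L Γ' R' s) : Inv p L Γ R (σ.plug s) := by
  induction h with
  | nil => exact hs
  | @cons n m Γ R v hv σ T A Γ' R' h _ ih => exact .cons hv h (ih hs)

/-- The division into store and body is not unique. If `σ` reaches into the body, the leading values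
there become store entries with footprint `cv(v)`. The opposite mismatch, an invariant with more
store than `σ`, is excluded by `hs`. -/
theorem Inv.decompose {p n m : ℕ} {L : Set ℕ} {Γ : Ctx n 0} {R : Fin n → Set ℕ}
    (σ : Store 0 n m) {s : Tm m 0} (hR : Γ.Sound R)
    (hs : ∀ v t, s = .letIn v t → v.isVal = false) (h : Inv p L Γ R (σ.plug s)) :
    ∃ Γ' R' T, StoreOK p Γ R σ Γ' R' ∧ p ≤ m ∧ HasType Γ' s T ∧ s.cv.footprint R' ⊆ L := by
  induction σ with
  | nil =>
    cases h with
    | cons hv => exact absurd hv (by simp [hs _ _ rfl])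
    | body hp ht hL => exact ⟨Γ, R, _, .nil, hp, ht, hL⟩
  | cons v hv σ ih =>
    cases h with
    | cons _ h hi =>
      obtain ⟨Γ', R', T, hσ, h'⟩ := ih (h.sound_consVar hR) hs hi
      exact ⟨Γ', R', T, .cons h hσ, h'⟩
    | body hp ht hL =>
      obtain ⟨U, hvU, ht⟩ := ht.letIn_inv
      have h := EntryOK.of_isVal hR hp hv hvU
      obtain ⟨Γ', R', T, hσ, h'⟩ := ih (h.sound_consVar hR) hs
        (.body (hp.trans (Nat.le_succ _)) ht (Tm.footprint_of_letIn hL))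
      exact ⟨Γ', R', T, .cons h hσ, h'⟩

/-- Decomposition at a redex `s`: every typed replacement of `s` in the footprint, possibly below
a lifted value, restores the invariant. -/
theorem Inv.redex {p n m : ℕ} {L : Set ℕ} {Γ : Ctx n 0} {R : Fin n → Set ℕ}
    (σ : Store 0 n m) (e : ECtx m 0) {s : Tm m 0} (hR : Γ.Sound R) (hP : PrimFootprint p R)
    (hs : s.isVal = false) (he : e = .hole → ∀ v t, s = .letIn v t → v.isVal = false)
    (h : Inv p L Γ R (σ.plug (e.plug s))) :
    ∃ Γ' R' U, (∀ x v, σ.Lookup x v → HasType Γ' v (Γ'.var x) ∧ v.cv.footprint R' ⊆ R' x) ∧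
      Γ'.Sound R' ∧ PrimFootprint p R' ∧ HasType Γ' s U ∧ s.cv.footprint R' ⊆ L ∧
      (∀ s', HasType Γ' s' U → s'.cv.footprint R' ⊆ L → Inv p L Γ R (σ.plug (e.plug s'))) ∧
      ∀ v t V, v.isVal = true → HasType Γ' v V → HasType (Γ'.consVar V) t U.wkVar →
        t.cv.footprint (extendFootprint (v.cv.footprint R') R') ⊆ L →
        Inv p L Γ R (σ.plug (.letIn v (e.wk.plug t))) := by
  obtain ⟨Γ', R', T, hσ, hp, hT, hL⟩ := Inv.decompose σ hR (fun v t hvt => by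
    cases e with
    | hole => exact he rfl v t hvt
    | letIn e u => cases hvt; exact e.isVal_plug hs) h
  obtain ⟨U, hU, h₁, h₂⟩ := e.typing hT
  obtain ⟨g, g₁, g₂⟩ := e.footprint hs hL
  refine ⟨Γ', R', U, fun _ _ => hσ.lookup, hσ.sound hR, hσ.prim hP, hU, g,
    fun s' hs' hL' => hσ.inv (.body hp (h₁ s' hs') (g₁ s' hL')), fun v t V hv hV ht htL => ?_⟩
  exact hσ.inv (.cons hv (.of_isVal (hσ.sound hR) hp hv hV)
    (.body (hp.trans (Nat.le_succ _)) (h₂ V t ht) (g₂ _ t htL)))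

theorem Step.inv {p n : ℕ} {L : Set ℕ} {Γ : Ctx n 0} {R : Fin n → Set ℕ} {a b : Tm n 0}
    (h : Step a b) (hR : Γ.Sound R) (hP : PrimFootprint p R) (ha : Inv p L Γ R a) :
    Inv p L Γ R b ∧ ∀ l ∈ h.used, l < p → l ∈ L := by
  cases h with
  | apply σ e x y U t hx =>
    obtain ⟨Γ', R', T, hl, -, hP', hT, hL, hI, -⟩ :=
      Inv.redex σ e hR hP rfl (fun _ _ _ h => by cases h) ha
    obtain ⟨hv, hvR⟩ := hl _ _ hx
    rw [CapSet.footprint_subset] at hL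
    have hxL := hL x (by simp [Tm.cv])
    have hyL := hL y (by simp [Tm.cv])
    refine ⟨hI _ (hv.apply_contract hT) ?_, fun l hl hlp => ?_⟩
    · rw [Tm.cv_ren, CapSet.footprint_ren_inst, CapSet.footprint_extend_subset]
      exact ⟨fun _ => hyL, hvR.trans hxL⟩
    · cases Finset.mem_singleton.1 hl
      -- The applied variable is captured by the redex, and as a primitive it is its own footprint.
      exact hxL (by rw [hP' x hlp]; rfl)
  | tapply σ e x S S' t hx =>
    obtain ⟨Γ', R', T, hl, -, hP', hT, hL, hI, -⟩ :=
      Inv.redex σ e hR hP rfl (fun _ _ _ h => by cases h) ha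
    obtain ⟨hv, hvR⟩ := hl _ _ hx
    have hxL := CapSet.footprint_subset.1 hL x (by simp [Tm.cv])
    refine ⟨hI _ (hv.tapply_contract hT) ?_, fun l hl hlp => ?_⟩
    · rw [Tm.cv_tsubst]
      exact hvR.trans hxL
    · cases Finset.mem_singleton.1 hl
      exact hxL (by rw [hP' x hlp]; rfl)
  | unboxing σ e C x y hx =>
    obtain ⟨Γ', R', T, hl, hR', -, hT, hL, hI, -⟩ :=
      Inv.redex σ e hR hP rfl (fun _ _ _ h => by cases h) ha
    obtain ⟨hy, hC, hn⟩ := (hl _ _ hx).1.unbox_contract hT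
    refine ⟨hI _ hy ?_, fun l hl => absurd hl (Finset.notMem_empty l)⟩
    -- The footprint of the content lies in that of the key, which is part of the captured variables
    -- of the redex.
    exact (hR'.subcapt hC hn).2.trans ((CapSet.footprint_mono Finset.subset_union_left).trans hL)
  | rename σ e y t =>
    obtain ⟨Γ', R', T, -, -, -, hT, hL, hI, -⟩ :=
      Inv.redex σ e hR hP rfl (fun _ _ _ h => by cases h; rfl) ha
    refine ⟨hI _ hT.rename_contract ?_, fun l hl => absurd hl (Finset.notMem_empty l)⟩
    have hyR : CapSet.footprint R' (Tm.var (k := 0) y).cv = R' y := by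
      ext l; simp [CapSet.footprint, Tm.cv]
    have := Tm.footprint_of_letIn hL
    rwa [hyR, ← CapSet.footprint_ren_inst, ← Tm.cv_ren _ id] at this
  | lift σ e v t hv he =>
    obtain ⟨Γ', R', T, -, -, -, hT, hL, -, hI⟩ :=
      Inv.redex σ e hR hP rfl (fun h => absurd h he) ha
    obtain ⟨V, hV, ht⟩ := hT.letIn_inv
    exact ⟨hI v t V hv hV ht (Tm.footprint_of_letIn hL),
      fun l hl => absurd hl (Finset.notMem_empty l)⟩

theorem Steps.used_subset {p n : ℕ} {L : Set ℕ} {Γ : Ctx n 0} {R : Fin n → Set ℕ} {a b : Tm n 0}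
    (r : Steps a b) (hR : Γ.Sound R) (hP : PrimFootprint p R) (ha : Inv p L Γ R a) :
    ∀ l ∈ r.used, l < p → l ∈ L := by
  induction r with
  | refl => exact fun l hl => absurd hl (Finset.notMem_empty l)
  | head h r ih =>
    intro l hl hlp
    obtain ⟨hb, hu⟩ := h.inv hR hP ha
    exact (Finset.mem_union.1 hl).elim (fun hl => hu l hl hlp) (fun hl => ih hb l hl hlp)

/-! ### Programs -/

theorem Matches.ren {k n m : ℕ} {Γ : Ctx n k} {σ : Store k n m} {Γ' : Ctx m k}
    (h : Matches Γ σ Γ') : Ctx.Ren Γ Γ' σ.wk id := by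
  induction h with
  | nil => exact .refl _
  | cons _ _ ih => exact (Ctx.Ren.wkVar _ _).trans ih

/-- The footprint of the platform: every variable stands for itself. -/
theorem extendFootprint_level (n : ℕ) :
    extendFootprint {n} (fun x : Fin n => {level x}) = fun x => {level x} := by
  funext x
  refine Fin.cases ?_ (fun x => ?_) x
  · rw [level_zero]; rfl
  · rw [level_succ]; rfl

/-- For platform entries soundness is vacuous, as the declared capture set contains `*`, and the
values capture no variables because they have no free ones. -/
theorem Matches.inv {n m : ℕ} {L : Set ℕ} {Γ : Ctx n 0} {σ : Store 0 n m} {Γ' : Ctx m 0}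
    (h : Matches Γ σ Γ') (hσ : σ.IsPlatform) (hΓ' : ∀ x, none ∈ (Γ'.var x).cap) {t : Tm m 0}
    {T : Ty m 0} (ht : HasType Γ' t T) (hL : t.cv.footprint (fun x => {level x}) ⊆ L) :
    Inv m L Γ (fun x => {level x}) (σ.plug t) := by
  induction h with
  | nil => exact .body le_rfl ht hL
  | @cons n m Γ v hv σ U Γ' h htv ih =>
    refine .cons (T := U) (A := {n}) hv ⟨htv, fun hU => absurd ?_ hU, ?_, fun _ => rfl⟩ ?_
    -- The presence of `*` is known only in the scope of the hole. It is pulled back along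
    -- weakening, which neither adds nor removes `*`.
    · have := hΓ' (σ.wk 0)
      rw [h.ren.var, Typ.cap_ren, CapSet.none_mem_ren] at this
      change none ∈ U.wkVar.cap at this
      rwa [Typ.wkVar, Typ.cap_ren, CapSet.none_mem_ren] at this
    · refine CapSet.footprint_subset.2 fun x hx => ?_
      have := v.mem_fv_of_mem_cv hx
      rw [hσ.1] at this
      exact absurd this (Finset.notMem_empty x)
    · rw [extendFootprint_level]
      exact ih hσ.2 hΓ' ht hL

end CaptureCalc

theorem mainTheorem5 {p : ℕ} (Ψ : CaptureCalc.Store 0 0 p) (t t' : CaptureCalc.Tm p 0)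
    (hprog : CaptureCalc.WellTypedProgram Ψ t)
    (r : CaptureCalc.Steps (Ψ.plug t) (Ψ.plug t')) :
    ∀ c ∈ CaptureCalc.primitivesUsed p r, some c ∈ t.cv := by
  obtain ⟨hΨ, Δ, hm, hΔ, T, hT⟩ := hprog
  intro c hc
  -- Reflexivity of inclusion fixes `L` as the set of levels of the variables in `cv(t)`.
  have hI := hm.inv hΨ (fun x => by
    obtain ⟨S, h⟩ := hΔ x
    rw [h]
    exact Finset.mem_singleton_self _) hT (Set.Subset.refl _)
  obtain ⟨x, hx, hl⟩ := r.used_subset (fun x => x.elim0) (fun x => x.elim0) hI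
    _ (Finset.mem_filter.1 hc).2 (CaptureCalc.level_lt c)
  rwa [CaptureCalc.level_injective hl]
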